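/- Let $\Phi(z,s,v)$ denote the Hurwitz–Lerch zeta function: the analytic continuation in $z$ to $\mathbb{C}\setminus[1,\infty)$ of $\sum_{j\ge 0} z^j/(v+j)^s$ ($|z|<1$), extended by continuity to those points of $[1,\infty)$ at which this is possible (for $s\in\{0,-1,-2,\dots\}$, where $\Phi$ is rational in $z$ with its only pole at $z=1$, these are all the points $z\neq 1$). Logarithms and powers are principal, with the conventions $0^0=1$, $0^w=0$ for $w\ne 0$, and a term of the defining series with $v+j=0$ is read as $z^j\cdot 0^{-s}$ when $-s\in\{0,1,2,\dots\}$. Let $\alpha,m,k,a\in\mathbb{C}$ with $a\neq 0$, $\operatorname{Re}\alpha>0$ and $|\operatorname{Im}(m\overline{\alpha})|<\frac{\pi}{2}\operatorname{Re}\alpha$. Assume that at least one of the following holds: (i) $k\in\{0,1,2,\dots\}$; (ii) $\alpha$ is real and $|a|>1$; (iii) $\alpha$ is real, $|a|=1$ and $\operatorname{Re}k>0$. Then both bilateral series below converge absolutely, and $$\sum_{n=-\infty}^{\infty}e^{\alpha n}\,\Phi\!\left(-e^{2(m+n\alpha)},-k,\tfrac12(\log a+1)\right) =\sum_{n=-\infty}^{\infty}\frac{\pi\,2^{-k-2}}{\alpha}\,e^{m\left(-1-\frac{2i\pi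 n}{\alpha}\right)}\operatorname{sech}\!\left(\frac{\pi^2 n}{\alpha}\right)\left(e^{\frac{4i\pi mn}{\alpha}}\Big(\log a+\frac{2i\pi n}{\alpha}\Big)^{k}+\Big(\log a-\frac{2i\pi n}{\alpha}\Big)^{k}\right).$$ -/

import Mathlib

/-- The cut plane `ℂ ∖ [1, ∞)`. -/
def lerchCutPlane : Set ℂ := {z : ℂ | ¬ (z.im = 0 ∧ 1 ≤ z.re)}

/-- `F` is the principal branch of `z ↦ Φ(z, s, v)`: a function holomorphic on the cut plane
`ℂ ∖ [1, ∞)` that is given on the open unit disc by the series `∑ z ^ n / (v + n) ^ s`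
(principal powers). The cut plane is connected, so two such functions agree on it. -/
def IsLerchBranch (s v : ℂ) (F : ℂ → ℂ) : Prop :=
  DifferentiableOn ℂ F lerchCutPlane ∧
    ∀ z : ℂ, ‖z‖ < 1 → HasSum (fun n : ℕ => z ^ n / (v + (n : ℂ)) ^ s) (F z)

open Classical in
/-- The Hurwitz-Lerch zeta function `Φ(z, s, v)`: the analytic continuation in `z`, to the cut
plane `ℂ ∖ [1, ∞)`, of `∑ z ^ n / (v + n) ^ s`, and then its continuous extension to those
points of the cut at which it has a limit (for `s = 0, -1, -2, …`, where `Φ` is a rational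
function of `z` whose only pole is at `1`, these are all the points of the cut except `1`). -/
noncomputable def lerchPhi (z s v : ℂ) : ℂ :=
  if h : ∃ F : ℂ → ℂ, IsLerchBranch s v F then extendFrom lerchCutPlane h.choose z else 0

open Complex Set Filter Topology MeasureTheory

/-! Put `L = log a` and `P(s) = (L + s)^k`. With `w = m + nα`, the left-hand term is `e^(-m)` times
`e^w Φ(-e^(2w), -k, (L+1)/2)`, and for `Re w < 0` the latter is `2^(-k) ∑ (-1)^j e^((2j+1)w)
P(2j+1)`. Up to a factor this is the sum of the residues of `P(s) e^(sw) / cos(πs/2)` at `s = 1, 3,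
5, …`, hence `2^(-k-2)` times the integral `T(w) = ∫ P(it) e^(itw) sech(πt/2) dt`
(`PolyGrowth.hasSum_sechTransform`). Both sides are holomorphic in the strip `|Im w| < π/2`, so the
formula persists there (`PolyGrowth.exp_mul_lerchPhi`).

`T` is a Fourier transform, so for real `α` Poisson summation turns `∑ T(m + nα)` into `2π/α` times
the sum of the integrand over `t = 2πn/α` (`PolyGrowth.poisson`). The integrand decays
exponentially; what needs work is the summability of `T(m + nα)`. If `Re L > 0`, or `Re L = 0` and
`Re k > 0`, the integrand has at worst an algebraic singularity at `t = -Im L`, and a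
second-difference argument gives `T(w + x) = O(|x|^(-1-σ))` with `σ > 0`. If `k` is a natural
number, `Φ` is rational in `z` and its terms decay exponentially.

For natural `k` and complex `α`, write `m = iy + cα` with `y`, `c` real; the hypothesis on `Im(m ᾱ)`
says exactly `|y| < π/2`. For fixed `y`, `c` both sides are holomorphic in `Re α > 0` and agree for
`α > 0`, hence everywhere (`lerchPoisson_natCast`). The stated right-hand side pairs the dual terms
of index `n` and `-n` (`dual_term_eq`). -/

/-! ### The cut plane and uniqueness of the branch. -/

theorem isOpen_lerchCutPlane : IsOpen lerchCutPlane := by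
  have : lerchCutPlane = ({z : ℂ | z.im = 0} ∩ {z : ℂ | 1 ≤ z.re})ᶜ := by
    ext z; simp [lerchCutPlane]
  rw [this, isOpen_compl_iff]
  exact (isClosed_eq continuous_im continuous_const).inter
    (isClosed_le continuous_const continuous_re)

theorem ball_subset_lerchCutPlane : Metric.ball (0 : ℂ) 1 ⊆ lerchCutPlane := by
  intro z hz h
  have := (le_abs_self z.re).trans (abs_re_le_norm z)
  rw [mem_ball_zero_iff] at hz
  linarith [h.2]

theorem mem_lerchCutPlane_of_norm_lt_one {z : ℂ} (hz : ‖z‖ < 1) : z ∈ lerchCutPlane :=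
  ball_subset_lerchCutPlane (mem_ball_zero_iff.2 hz)

theorem isPreconnected_lerchCutPlane : IsPreconnected lerchCutPlane := by
  have h : StarConvex ℝ (0 : ℂ) lerchCutPlane := by
    rw [starConvex_zero_iff]
    intro z hz t ht0 ht1 hzt
    apply hz
    simp only [real_smul, mul_im, ofReal_re, ofReal_im, zero_mul, add_zero, mul_re,
      sub_zero] at hzt
    have ht : 0 < t := by
      rcases ht0.eq_or_lt with rfl | h
      · norm_num at hzt
      · exact h
    refine ⟨by simpa [ht.ne'] using hzt.1, ?_⟩
    nlinarith [hzt.2]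
  exact (h.isPathConnected (mem_lerchCutPlane_of_norm_lt_one (by simp))).isConnected.isPreconnected

theorem dense_lerchCutPlane : Dense lerchCutPlane := by
  have : lerchCutPlane = ({z : ℂ | z.im = 0} ∩ {z : ℂ | 1 ≤ z.re})ᶜ := by
    ext z; simp [lerchCutPlane]
  rw [this, ← interior_eq_empty_iff_dense_compl, eq_empty_iff_forall_notMem]
  intro z hz
  have h2 := interior_mono (inter_subset_left (t := {z : ℂ | 1 ≤ z.re})) hz
  have h3 : interior {z : ℂ | z.im = 0} = ∅ := by
    rw [show {z : ℂ | z.im = 0} = Complex.im ⁻¹' {0} from rfl, interior_preimage_im]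
    simp
  rw [h3] at h2
  exact h2

/-- Identity theorem from the unit disc. It makes the arbitrary choice of branch inside `lerchPhi`
irrelevant. -/
theorem IsLerchBranch.eqOn {s v : ℂ} {F G : ℂ → ℂ} (hF : IsLerchBranch s v F)
    (hG : IsLerchBranch s v G) : EqOn F G lerchCutPlane := by
  refine (hF.1.analyticOnNhd isOpen_lerchCutPlane).eqOn_of_preconnected_of_eventuallyEq
    (hG.1.analyticOnNhd isOpen_lerchCutPlane) isPreconnected_lerchCutPlane
    (z₀ := 0) (mem_lerchCutPlane_of_norm_lt_one (by simp)) ?_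
  filter_upwards [Metric.ball_mem_nhds (0 : ℂ) one_pos] with z hz
  rw [mem_ball_zero_iff] at hz
  exact (hF.2 z hz).unique (hG.2 z hz)

/-- A branch computes `lerchPhi` wherever it is continuous. -/
theorem IsLerchBranch.lerchPhi_eq_of_tendsto {s v : ℂ} {F : ℂ → ℂ} (hF : IsLerchBranch s v F)
    {z : ℂ} (hz : Tendsto F (𝓝[lerchCutPlane] z) (𝓝 (F z))) : lerchPhi z s v = F z := by
  have h : ∃ F : ℂ → ℂ, IsLerchBranch s v F := ⟨F, hF⟩
  rw [lerchPhi, dif_pos h]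
  refine extendFrom_eq (dense_lerchCutPlane z) (hz.congr' ?_)
  filter_upwards [self_mem_nhdsWithin] with y hy
  exact hF.eqOn h.choose_spec hy

theorem IsLerchBranch.lerchPhi_eq {s v : ℂ} {F : ℂ → ℂ} (hF : IsLerchBranch s v F)
    {z : ℂ} (hz : z ∈ lerchCutPlane) : lerchPhi z s v = F z :=
  hF.lerchPhi_eq_of_tendsto ((hF.1 z hz).continuousWithinAt)

/-! ### Exponential estimates and the Fourier transform of sech. -/

theorem one_add_pow_le_exp {c : ℝ} (hc : 0 < c) (n : ℕ) :
    ∃ K : ℝ, 0 < K ∧ ∀ x : ℝ, 0 ≤ x → (1 + x) ^ n ≤ K * Real.exp (c * x) := by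
  refine ⟨n.factorial / c ^ n * Real.exp c, by positivity, fun x hx => ?_⟩
  have h := Real.pow_div_factorial_le_exp (c * (1 + x)) (by positivity) n
  rw [div_le_iff₀ (by positivity), mul_pow] at h
  rw [mul_assoc, ← Real.exp_add, show c + c * x = c * (1 + x) by ring, div_mul_eq_mul_div,
    le_div_iff₀ (by positivity)]
  linarith

theorem integrable_one_add_abs_pow_mul_exp {c : ℝ} (hc : 0 < c) (n : ℕ) :
    Integrable fun t : ℝ => (1 + |t|) ^ n * Real.exp (-c * |t|) := by
  obtain ⟨K, hK, h⟩ := one_add_pow_le_exp hc (n + 2)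
  have hi : Integrable fun t : ℝ => (1 + ‖t‖) ^ (-2 : ℝ) :=
    integrable_one_add_norm (by simp)
  refine (hi.const_mul K).mono' (by fun_prop) (Eventually.of_forall fun t => ?_)
  rw [Real.norm_of_nonneg (by positivity), Real.norm_eq_abs, Real.rpow_neg (by positivity),
    Real.rpow_two, ← div_eq_mul_inv, le_div_iff₀ (by positivity), neg_mul, Real.exp_neg,
    mul_right_comm, ← pow_add, ← div_eq_mul_inv, div_le_iff₀ (by positivity)]
  exact h _ (abs_nonneg t)

theorem exp_abs_le_two_mul_cosh (x : ℝ) : Real.exp |x| ≤ 2 * Real.cosh x := by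
  rw [← Real.cosh_abs, Real.cosh_eq]
  linarith [Real.exp_pos (-|x|)]

theorem cosh_pi_mul_div_two (t : ℝ) :
    Complex.cosh (Real.pi * t / 2) = ((Real.cosh (Real.pi * t / 2) : ℝ) : ℂ) := by
  push_cast; rfl

theorem cosh_pi_mul_div_two_ne_zero (t : ℝ) : Complex.cosh (Real.pi * t / 2) ≠ 0 := by
  rw [cosh_pi_mul_div_two, ofReal_ne_zero]
  exact (Real.cosh_pos _).ne'

theorem norm_exp_div_cosh_le (t : ℝ) (w : ℂ) :
    ‖cexp (t * I * w) / Complex.cosh (Real.pi * t / 2)‖ ≤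
      2 * Real.exp (-(Real.pi / 2 - |w.im|) * |t|) := by
  rw [norm_div, norm_exp, cosh_pi_mul_div_two, norm_real,
    Real.norm_of_nonneg (Real.cosh_pos _).le, div_le_iff₀ (Real.cosh_pos _)]
  have h1 := exp_abs_le_two_mul_cosh (Real.pi * t / 2)
  have h2 : |Real.pi * t / 2| = Real.pi / 2 * |t| := by
    rw [show Real.pi * t / 2 = Real.pi / 2 * t by ring, abs_mul, abs_of_pos (by positivity)]
  rw [h2] at h1
  have h3 : (t * I * w).re ≤ |w.im| * |t| := by
    have : (t * I * w).re = -(w.im * t) := by simp [mul_comm]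
    rw [this, ← abs_mul]
    exact neg_le_abs _
  calc Real.exp (t * I * w).re ≤ Real.exp (|w.im| * |t|) := Real.exp_le_exp.2 h3
    _ = Real.exp (-(Real.pi / 2 - |w.im|) * |t|) * Real.exp (Real.pi / 2 * |t|) := by
        rw [← Real.exp_add]; ring_nf
    _ ≤ Real.exp (-(Real.pi / 2 - |w.im|) * |t|) * (2 * Real.cosh (Real.pi * t / 2)) := by
        gcongr
    _ = _ := by ring

theorem cosh_ne_zero_of_abs_im_lt {w : ℂ} (hw : |w.im| < Real.pi / 2) : Complex.cosh w ≠ 0 := by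
  intro h
  have h1 : Complex.normSq (Complex.cosh w) = 0 := by simp [h]
  rw [← re_add_im w, Complex.cosh_add, Complex.cosh_mul_I, Complex.sinh_mul_I, normSq_apply] at h1
  simp only [← ofReal_cosh, ← ofReal_sinh, ← ofReal_cos, ← ofReal_sin] at h1
  simp [-ofReal_cosh, -ofReal_sinh, -ofReal_cos, -ofReal_sin] at h1
  have hc := Real.cos_pos_of_mem_Ioo ⟨(abs_lt.1 hw).1, (abs_lt.1 hw).2⟩
  have : 0 < Real.cosh w.re * Real.cos w.im := mul_pos (Real.cosh_pos _) hc
  nlinarith [sq_nonneg (Real.sinh w.re * Real.sin w.im)]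

/-- The Fourier transform of the hyperbolic secant. -/
theorem integral_exp_div_cosh {w : ℂ} (hw : |w.im| < Real.pi / 2) :
    ∫ t : ℝ, cexp (t * I * w) / Complex.cosh (Real.pi * t / 2) = 2 / Complex.cosh w := by
  -- The strip condition is `0 < Re u < 1`. Euler reflection evaluates the Beta integral at `(u, 1 -
  -- u)` as `π / sin(πu)`, and `sin(πu) = cosh w`.
  have hpi := Real.pi_pos
  set u : ℂ := 1 / 2 + I * w / Real.pi with hu
  have hure : u.re = 1 / 2 - w.im / Real.pi := by
    rw [hu, ← ofReal_one, show (2 : ℂ) = ((2 : ℝ) : ℂ) by simp]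
    rw [add_re, div_ofReal_re, div_ofReal_re]
    simp; ring
  obtain ⟨hw1, hw2⟩ := abs_lt.1 hw
  have hu0 : 0 < u.re := by
    rw [hure, sub_pos, div_lt_div_iff₀ hpi two_pos]; linarith
  have hu1 : 0 < (1 - u).re := by
    rw [sub_re, one_re, hure, show 1 - (1 / 2 - w.im / Real.pi) = 1 / 2 - (-w.im) / Real.pi by ring,
      sub_pos, div_lt_div_iff₀ hpi two_pos]; linarith
  have hB := Gamma_mul_Gamma_eq_betaIntegral hu0 hu1
  rw [Gamma_mul_Gamma_one_sub, add_sub_cancel, Complex.Gamma_one, one_mul] at hB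
  -- Logistic substitution `x = 1/(1 + e^(-y))`: with its Jacobian `x(1 - x)` the integrand becomes
  -- `x^u (1-x)^(1-u)`, and `x`, `1 - x` equal `e^(±y/2) / (2 cosh(y/2))`.
  have hsub : Complex.betaIntegral u (1 - u) =
      ∫ y : ℝ, cexp (y * (u - 1 / 2)) / (2 * Complex.cosh (y / 2)) := by
    rw [Complex.betaIntegral, intervalIntegral.integral_of_le zero_le_one,
      integral_Ioc_eq_integral_Ioo, ← Real.range_sigmoid, ← image_univ,
      integral_image_eq_integral_abs_deriv_smul MeasurableSet.univ
        (fun x _ => (Real.hasDerivAt_sigmoid x).hasDerivWithinAt)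
        Real.sigmoid_injective.injOn, setIntegral_univ]
    refine integral_congr_ae (Eventually.of_forall fun y => ?_)
    have h1 := Real.sigmoid_pos y
    have h2 : 0 < 1 - Real.sigmoid y := sub_pos.2 (Real.sigmoid_lt_one y)
    set x := Real.sigmoid y with hx
    have hl : ((Real.log x : ℝ) : ℂ) = y / 2 - (Real.log (2 * Real.cosh (y / 2)) : ℝ) := by
      have : x = Real.exp (y / 2) / (2 * Real.cosh (y / 2)) := by
        rw [hx, Real.sigmoid_def, Real.cosh_eq, inv_eq_one_div, div_eq_div_iff (by positivity)
          (by positivity), mul_add, ← Real.exp_add]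
        rw [show y / 2 + -y = -(y / 2) by ring]; ring
      rw [this, Real.log_div (by positivity) (mul_pos two_pos (Real.cosh_pos _)).ne', Real.log_exp]
      push_cast; ring
    have hl2 : ((Real.log (1 - x) : ℝ) : ℂ) =
        -(y / 2) - (Real.log (2 * Real.cosh (y / 2)) : ℝ) := by
      have : 1 - x = Real.exp (-(y / 2)) / (2 * Real.cosh (y / 2)) := by
        rw [hx, ← Real.sigmoid_neg, Real.sigmoid_def, Real.cosh_eq, inv_eq_one_div, neg_neg,
          div_eq_div_iff (by positivity)
          (by positivity), mul_add, ← Real.exp_add]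
        rw [show -(y / 2) + y = (y / 2) by ring]; ring
      rw [this, Real.log_div (by positivity) (mul_pos two_pos (Real.cosh_pos _)).ne', Real.log_exp]
      push_cast; ring
    have e1 : ((x * (1 - x) : ℝ) : ℂ) = cexp ((Real.log x : ℝ) + (Real.log (1 - x) : ℝ)) := by
      rw [← ofReal_add, ← Real.log_mul h1.ne' h2.ne', ← ofReal_exp, Real.exp_log (by positivity)]
    have e2 : (2 * Complex.cosh (y / 2)) = cexp ((Real.log (2 * Real.cosh (y / 2)) : ℝ)) := by
      rw [← ofReal_exp, Real.exp_log (mul_pos two_pos (Real.cosh_pos _))]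
      push_cast; rfl
    have e3 : (1 : ℂ) - (x : ℂ) = ((1 - x : ℝ) : ℂ) := by push_cast; rfl
    simp only
    rw [abs_of_pos (by positivity), real_smul, e1, e3, cpow_def_of_ne_zero (by exact_mod_cast h1.ne'),
      cpow_def_of_ne_zero (by exact_mod_cast h2.ne'), ← ofReal_log h1.le, ← ofReal_log h2.le,
      ← Complex.exp_add, ← Complex.exp_add, e2, ← Complex.exp_sub, hl, hl2]
    congr 1
    ring
  have hscale : ∫ t : ℝ, cexp (t * I * w) / Complex.cosh (Real.pi * t / 2) =
      (2 / Real.pi) * ∫ y : ℝ, cexp (y * (u - 1 / 2)) / (2 * Complex.cosh (y / 2)) := by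
    have h := Measure.integral_comp_mul_left
      (fun y : ℝ => cexp (y * (u - 1 / 2)) / (2 * Complex.cosh (y / 2))) Real.pi
    rw [abs_of_pos (by positivity), real_smul] at h
    have h4 : ∀ t : ℝ, cexp (((Real.pi * t : ℝ) : ℂ) * (u - 1 / 2)) /
        (2 * Complex.cosh (((Real.pi * t : ℝ) : ℂ) / 2)) =
        (1 / 2) * (cexp (t * I * w) / Complex.cosh (Real.pi * t / 2)) := by
      intro t
      have : ((Real.pi * t : ℝ) : ℂ) * (u - 1 / 2) = t * I * w := by
        have : (Real.pi : ℂ) ≠ 0 := by exact_mod_cast hpi.ne'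
        rw [hu]; push_cast; field_simp; ring
      rw [this]
      push_cast
      have := cosh_pi_mul_div_two_ne_zero t
      field_simp
    simp_rw [h4] at h
    rw [integral_const_mul] at h
    push_cast at h
    have : (Real.pi : ℂ) ≠ 0 := by exact_mod_cast hpi.ne'
    generalize (∫ t : ℝ, cexp (t * I * w) / Complex.cosh (Real.pi * t / 2)) = A at h ⊢
    generalize (∫ y : ℝ, cexp (y * (u - 1 / 2)) / (2 * Complex.cosh (y / 2))) = B at h ⊢
    field_simp at h ⊢
    linear_combination h
  rw [hscale, ← hsub, ← hB]
  have h5 : Complex.sin (Real.pi * u) = Complex.cosh w := by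
    have : (Real.pi : ℂ) ≠ 0 := by exact_mod_cast hpi.ne'
    rw [hu, ← Complex.cos_mul_I, show (Real.pi : ℂ) * (1 / 2 + I * w / Real.pi) =
      w * I + Real.pi / 2 by field_simp; ring, Complex.sin_add_pi_div_two]
  rw [h5]
  have : (Real.pi : ℂ) ≠ 0 := by exact_mod_cast hpi.ne'
  have := cosh_ne_zero_of_abs_im_lt hw
  field_simp

/-! ### Lower bounds for cosh and zeros of cos. -/

theorem sinh_abs_re_le_norm_cosh (z : ℂ) : Real.sinh |z.re| ≤ ‖Complex.cosh z‖ := by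
  have h1 : ‖Complex.cosh z‖ = ‖cexp z + cexp (-z)‖ / 2 := by
    rw [Complex.cosh, norm_div]; simp
  rw [h1, Real.sinh_eq]
  have e1 : ‖cexp z‖ = Real.exp z.re := norm_exp z
  have e2 : ‖cexp (-z)‖ = Real.exp (-z.re) := by rw [norm_exp, neg_re]
  have h2 := norm_sub_norm_le (cexp z) (-cexp (-z))
  have h3 := norm_sub_norm_le (cexp (-z)) (-cexp z)
  rw [norm_neg, sub_neg_eq_add, e1, e2] at h2 h3
  rw [add_comm] at h3
  rcases abs_cases z.re with ⟨h, _⟩ | ⟨h, _⟩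
  · rw [h]; linarith
  · rw [h, neg_neg]; linarith

theorem exp_le_four_mul_sinh {x : ℝ} (hx : 1 ≤ x) : Real.exp x ≤ 4 * Real.sinh x := by
  rw [Real.sinh_eq]
  have h1 : Real.exp (-x) ≤ 1 := Real.exp_le_one_iff.2 (by linarith)
  have h2 : 1 + 1 ≤ Real.exp x := (by linarith : (1 : ℝ) + 1 ≤ x + 1).trans (Real.add_one_le_exp x)
  linarith

theorem exp_abs_re_le_norm_cosh {z : ℂ} (hz : 1 ≤ |z.re|) :
    Real.exp |z.re| ≤ 4 * ‖Complex.cosh z‖ :=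
  (exp_le_four_mul_sinh hz).trans (by linarith [sinh_abs_re_le_norm_cosh z])

theorem eq_one_of_cos_pi_mul_div_two_eq_zero {s : ℂ} (h0 : 0 ≤ s.re) (h2 : s.re ≤ 2)
    (h : Complex.cos (Real.pi * s / 2) = 0) : s = 1 := by
  obtain ⟨k, hk⟩ := Complex.cos_eq_zero_iff.1 h
  have hpi : (Real.pi : ℂ) ≠ 0 := by exact_mod_cast Real.pi_ne_zero
  have hs : s = 2 * k + 1 := by
    field_simp at hk
    exact hk
  have hre : s.re = 2 * k + 1 := by rw [hs]; simp
  rw [hre] at h0 h2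
  have hk0 : k = 0 := by
    have h3 : (-1 : ℝ) < k := by linarith
    have h4 : (k : ℝ) < 1 := by linarith
    have h5 : -1 < k := by exact_mod_cast h3
    have h6 : k < 1 := by exact_mod_cast h4
    omega
  rw [hs, hk0]; simp

/-! ### The sech transform and its residue series. -/

/-- Functions on the closed right half plane, holomorphic inside and of polynomial growth. -/
structure PolyGrowth (P : ℂ → ℂ) : Prop where
  cont : ContinuousOn P {s | 0 ≤ s.re}
  diff : DifferentiableOn ℂ P {s | 0 < s.re}
  bound : ∃ C : ℝ, ∃ M : ℕ, 0 ≤ C ∧ ∀ s : ℂ, 0 ≤ s.re → ‖P s‖ ≤ C * (1 + ‖s‖) ^ M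

/-- The Fourier-type integral `∫ P(it) e^{itw} sech(πt/2) dt`. -/
noncomputable def sechTransform (P : ℂ → ℂ) (w : ℂ) : ℂ :=
  ∫ t : ℝ, P (t * I) * (cexp (t * I * w) / Complex.cosh (Real.pi * t / 2))

theorem PolyGrowth.continuous_mul_I {P : ℂ → ℂ} (hP : PolyGrowth P) :
    Continuous fun t : ℝ => P (t * I) :=
  hP.cont.comp_continuous (by fun_prop) (by simp)

theorem PolyGrowth.shift {P : ℂ → ℂ} (hP : PolyGrowth P) {r : ℝ} (hr : 0 ≤ r) :
    PolyGrowth fun s => P (s + r) := by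
  refine ⟨hP.cont.comp (by fun_prop) fun s hs => ?_, hP.diff.comp (by fun_prop) fun s hs => ?_, ?_⟩
  · simp only [mem_ofPred_eq, add_re, ofReal_re] at hs ⊢; linarith
  · simp only [mem_ofPred_eq, add_re, ofReal_re] at hs ⊢; linarith
  · obtain ⟨C, M, hC, h⟩ := hP.bound
    refine ⟨C * (1 + r) ^ M, M, by positivity, fun s hs => ?_⟩
    refine (h (s + r) (by simp; linarith)).trans ?_
    rw [mul_assoc, ← mul_pow]
    have : ‖s + r‖ ≤ ‖s‖ + r := (norm_add_le _ _).trans (by simp [abs_of_nonneg hr])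
    gcongr
    nlinarith [norm_nonneg s]

theorem norm_ofReal_mul_I (t : ℝ) : ‖(t : ℂ) * I‖ = |t| := by simp

theorem continuous_exp_div_cosh (w : ℂ) :
    Continuous fun t : ℝ => cexp (t * I * w) / Complex.cosh (Real.pi * t / 2) :=
  Continuous.div (by fun_prop) (by fun_prop) cosh_pi_mul_div_two_ne_zero

theorem norm_sechTransform_integrand_le {P : ℂ → ℂ} {C : ℝ} {M : ℕ} (hC : 0 ≤ C)
    (h : ∀ s : ℂ, 0 ≤ s.re → ‖P s‖ ≤ C * (1 + ‖s‖) ^ M) (w : ℂ) (t : ℝ) :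
    ‖P (t * I) * (cexp (t * I * w) / Complex.cosh (Real.pi * t / 2))‖ ≤
      2 * C * ((1 + |t|) ^ M * Real.exp (-(Real.pi / 2 - |w.im|) * |t|)) := by
  rw [norm_mul]
  calc _ ≤ (C * (1 + |t|) ^ M) * (2 * Real.exp (-(Real.pi / 2 - |w.im|) * |t|)) := by
        gcongr
        · simpa [norm_ofReal_mul_I] using h (t * I) (by simp)
        · exact norm_exp_div_cosh_le t w
    _ = _ := by ring

theorem PolyGrowth.integrable {P : ℂ → ℂ} (hP : PolyGrowth P) {w : ℂ}
    (hw : |w.im| < Real.pi / 2) : Integrable fun t : ℝ =>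
      P (t * I) * (cexp (t * I * w) / Complex.cosh (Real.pi * t / 2)) := by
  obtain ⟨C, M, hC, h⟩ := hP.bound
  exact ((integrable_one_add_abs_pow_mul_exp (sub_pos.2 hw) M).const_mul (2 * C)).mono'
    (hP.continuous_mul_I.mul (continuous_exp_div_cosh w)).aestronglyMeasurable
    (Eventually.of_forall fun t => norm_sechTransform_integrand_le hC h w t)

theorem polyGrowth_const (c : ℂ) : PolyGrowth fun _ => c :=
  ⟨continuousOn_const, differentiableOn_const _, ‖c‖, 0, norm_nonneg _, by simp⟩

theorem sechTransform_const (c : ℂ) {w : ℂ} (hw : |w.im| < Real.pi / 2) :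
    sechTransform (fun _ => c) w = c * (2 / Complex.cosh w) := by
  rw [sechTransform, integral_const_mul, integral_exp_div_cosh hw]

/-- Moving the line of integration from `Re s = 0` to `Re s = 2` past the pole at `s = 1`. -/
theorem PolyGrowth.sechTransform_add_shift {P : ℂ → ℂ} (hP : PolyGrowth P) {w : ℂ}
    (hw : |w.im| < Real.pi / 2) :
    sechTransform P w + cexp (2 * w) * sechTransform (fun s => P (s + 2)) w =
      4 * cexp w * P 1 := by
  set cf : ℂ → ℂ := fun s => Complex.cos (Real.pi * s / 2) with hcf
  have hcfd : Differentiable ℂ cf := by fun_prop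
  have hpi : (Real.pi : ℂ) ≠ 0 := by exact_mod_cast Real.pi_ne_zero
  have hcf1 : cf 1 = 0 := by simp [hcf, Complex.cos_pi_div_two]
  have hcfd1 : deriv cf 1 ≠ 0 := by
    have h1 : HasDerivAt cf (-Complex.sin (Real.pi * 1 / 2) * (Real.pi * 1 / 2)) 1 :=
      ((((hasDerivAt_id (1 : ℂ)).const_mul (Real.pi : ℂ)).div_const 2)).ccos
    rw [h1.deriv, mul_one, Complex.sin_pi_div_two]
    simp [hpi]
  have hne : ∀ s : ℂ, 0 ≤ s.re → s.re ≤ 2 → dslope cf 1 s ≠ 0 := by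
    intro s h0 h2
    by_cases hs : s = 1
    · rw [hs, dslope_same]; exact hcfd1
    · rw [dslope_of_ne _ hs, slope_def_field, hcf1, sub_zero]
      exact div_ne_zero (fun h => hs (eq_one_of_cos_pi_mul_div_two_eq_zero h0 h2 h))
        (sub_ne_zero.2 hs)
  -- Subtracting `P 1` cancels the simple zero of `cos(πs/2)` at `s = 1`. As a quotient of
  -- difference quotients `Q` is regular on the strip, so Cauchy's theorem on rectangles replaces
  -- the residue theorem; the constant is restored at the end from the explicit transform of sech.
  set Q : ℂ → ℂ := fun s => dslope P 1 s * cexp (s * w) / dslope cf 1 s with hQ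
  have hQne : ∀ s : ℂ, s ≠ 1 → Q s = (P s - P 1) * (cexp (s * w) / cf s) := by
    intro s hs
    have : s - 1 ≠ 0 := sub_ne_zero.2 hs
    simp only [hQ, dslope_of_ne _ hs, slope_def_field, hcf1, sub_zero]
    by_cases h : cf s = 0
    · simp [h]
    · field_simp
  have h1mem : {s : ℂ | 0 ≤ s.re} ∈ 𝓝 (1 : ℂ) := by
    filter_upwards [(isOpen_lt continuous_const continuous_re).mem_nhds
      (show (0 : ℝ) < (1 : ℂ).re by simp)] with s hs using le_of_lt hs
  have hopen : IsOpen {s : ℂ | 0 < s.re} := isOpen_lt continuous_const continuous_re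
  have h1mem' : {s : ℂ | 0 < s.re} ∈ 𝓝 (1 : ℂ) := hopen.mem_nhds (by simp)
  have hdcf : Differentiable ℂ (dslope cf 1) := by
    rw [← differentiableOn_univ, Complex.differentiableOn_dslope univ_mem]
    exact hcfd.differentiableOn
  have hdP : ContinuousOn (dslope P 1) {s | 0 ≤ s.re} :=
    (continuousOn_dslope h1mem).2 ⟨hP.cont, hP.diff.differentiableAt h1mem'⟩
  have hdP' : DifferentiableOn ℂ (dslope P 1) {s | 0 < s.re} :=
    (Complex.differentiableOn_dslope h1mem').2 hP.diff
  have hrect : ∀ T : ℝ, (∫ x : ℝ in (0 : ℝ)..2, Q (x + (-T : ℝ) * I)) -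
      (∫ x : ℝ in (0 : ℝ)..2, Q (x + T * I)) +
      I • (∫ y : ℝ in (-T)..T, Q ((2 : ℝ) + y * I)) -
      I • (∫ y : ℝ in (-T)..T, Q ((0 : ℝ) + y * I)) = 0 := by
    intro T
    refine Complex.integral_boundary_rect_eq_zero_of_continuousOn_of_differentiableOn Q
      ⟨0, -T⟩ ⟨2, T⟩ ?_ ?_
    · have hsub : (uIcc (0 : ℝ) 2 ×ℂ uIcc (-T) T) ⊆ {s : ℂ | 0 ≤ s.re ∧ s.re ≤ 2} := by
        intro s hs
        rw [mem_reProdIm, uIcc_of_le zero_le_two] at hs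
        exact hs.1
      refine ContinuousOn.mono ?_ hsub
      refine ((hdP.mono fun s hs => hs.1).mul (by fun_prop)).div
        hdcf.continuous.continuousOn fun s hs => hne s hs.1 hs.2
    · have hsub : (Ioo (min (0 : ℝ) 2) (max (0 : ℝ) 2) ×ℂ Ioo (min (-T) T) (max (-T) T)) ⊆
          {s : ℂ | 0 < s.re ∧ s.re < 2} := by
        intro s hs
        rw [mem_reProdIm, min_eq_left zero_le_two, max_eq_right zero_le_two] at hs
        exact hs.1
      refine DifferentiableOn.mono ?_ hsub
      refine ((hdP'.mono fun s hs => hs.1).mul (by fun_prop)).div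
        hdcf.differentiableOn fun s hs => hne s hs.1.le hs.2.le
  obtain ⟨C, M, hC, hb⟩ := hP.bound
  set c : ℝ := Real.pi / 2 - |w.im| with hc
  have hc0 : 0 < c := sub_pos.2 hw
  -- Half of the decay rate `c` absorbs the polynomial growth of `P`; the other half makes the
  -- horizontal sides vanish as `T → ∞`.
  obtain ⟨K, hK, hKb⟩ := one_add_pow_le_exp (half_pos hc0) M
  set D : ℝ := 2 * C * 3 ^ M * K * Real.exp (2 * |w.re|) * 4 with hD
  have hQb : ∀ T : ℝ, 1 ≤ |T| → ∀ x : ℝ, 0 ≤ x → x ≤ 2 →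
      ‖Q (x + T * I)‖ ≤ D * Real.exp (-(c / 2) * |T|) := by
    intro T hT x hx0 hx2
    set s : ℂ := x + T * I with hs
    have hsre : s.re = x := by simp [hs]
    have hsim : s.im = T := by simp [hs]
    have hs1 : s ≠ 1 := by
      intro h
      rw [← hsim, h] at hT
      norm_num at hT
    have hsn : ‖s‖ ≤ 2 + |T| := by
      refine (norm_add_le _ _).trans ?_
      rw [norm_ofReal_mul_I, norm_real, Real.norm_of_nonneg hx0]
      linarith
    rw [hQne s hs1, norm_mul, norm_div]
    have h1 : ‖P s - P 1‖ ≤ 2 * C * 3 ^ M * K * Real.exp (c / 2 * |T|) := by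
      have a1 : ‖P s‖ ≤ C * (3 * (1 + |T|)) ^ M := by
        refine (hb s (by rw [hsre]; exact hx0)).trans ?_
        gcongr
        linarith
      have a2 : ‖P 1‖ ≤ C * (3 * (1 + |T|)) ^ M := by
        refine (hb 1 (by simp)).trans ?_
        gcongr
        rw [norm_one]
        linarith
      have a3 := hKb |T| (abs_nonneg T)
      calc ‖P s - P 1‖ ≤ 2 * C * 3 ^ M * (1 + |T|) ^ M := by
            refine (norm_sub_le _ _).trans ?_
            rw [mul_pow] at a1 a2
            linarith
        _ ≤ 2 * C * 3 ^ M * (K * Real.exp (c / 2 * |T|)) := by gcongr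
        _ = _ := by ring
    have h2 : ‖cexp (s * w)‖ ≤ Real.exp (2 * |w.re|) * Real.exp (|w.im| * |T|) := by
      rw [norm_exp, ← Real.exp_add, Real.exp_le_exp, mul_re, hsre, hsim]
      have b1 : x * w.re ≤ 2 * |w.re| := by
        calc x * w.re ≤ x * |w.re| := by gcongr; exact le_abs_self _
          _ ≤ 2 * |w.re| := by gcongr
      have b2 : -(T * w.im) ≤ |w.im| * |T| := by
        rw [mul_comm, ← abs_mul]; exact neg_le_abs _
      linarith
    have h3 : Real.exp (Real.pi / 2 * |T|) ≤ 4 * ‖cf s‖ := by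
      have e : cf s = Complex.cosh (Real.pi * s / 2 * I) := by rw [hcf, Complex.cosh_mul_I]
      have e2 : (Real.pi * s / 2 * I).re = -(Real.pi / 2 * T) := by
        rw [show (Real.pi * s / 2 * I) = ((Real.pi / 2 : ℝ) : ℂ) * (s * I) by push_cast; ring,
          re_ofReal_mul]
        simp [hs]
      have e3 : |(Real.pi * s / 2 * I).re| = Real.pi / 2 * |T| := by
        rw [e2, abs_neg, abs_mul, abs_of_pos (by positivity)]
      have := exp_abs_re_le_norm_cosh (z := Real.pi * s / 2 * I)
        (by rw [e3]; nlinarith [Real.pi_gt_three])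
      rwa [e3, ← e] at this
    have hcfpos : 0 < ‖cf s‖ := by linarith [Real.exp_pos (Real.pi / 2 * |T|)]
    have h4 : ‖cexp (s * w)‖ / ‖cf s‖ ≤
        Real.exp (2 * |w.re|) * 4 * Real.exp (-c * |T|) := by
      rw [div_le_iff₀ hcfpos]
      calc _ ≤ Real.exp (2 * |w.re|) * Real.exp (|w.im| * |T|) := h2
        _ = Real.exp (2 * |w.re|) * Real.exp (-c * |T|) * Real.exp (Real.pi / 2 * |T|) := by
            rw [← Real.exp_add, ← Real.exp_add, ← Real.exp_add, hc]; ring_nf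
        _ ≤ Real.exp (2 * |w.re|) * Real.exp (-c * |T|) * (4 * ‖cf s‖) := by gcongr
        _ = _ := by ring
    calc _ ≤ (2 * C * 3 ^ M * K * Real.exp (c / 2 * |T|)) *
          (Real.exp (2 * |w.re|) * 4 * Real.exp (-c * |T|)) := by gcongr
      _ = D * (Real.exp (c / 2 * |T|) * Real.exp (-c * |T|)) := by rw [hD]; ring
      _ = _ := by rw [← Real.exp_add]; ring_nf
  have hlim0 : Tendsto (fun T : ℝ => D * Real.exp (-(c / 2) * |T|) * |(2 : ℝ) - 0|) atTop
      (𝓝 0) := by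
    have : Tendsto (fun T : ℝ => Real.exp (-(c / 2) * |T|)) atTop (𝓝 0) := by
      refine Real.tendsto_exp_atBot.comp ?_
      refine Tendsto.const_mul_atTop_of_neg (by linarith) tendsto_abs_atTop_atTop
    simpa using (this.const_mul D).mul_const |(2 : ℝ) - 0|
  have hhor : ∀ ε : ℝ, |ε| = 1 →
      Tendsto (fun T : ℝ => ∫ x : ℝ in (0 : ℝ)..2, Q (x + (ε * T : ℝ) * I)) atTop (𝓝 0) := by
    intro ε hε
    refine squeeze_zero_norm' ?_ hlim0
    filter_upwards [eventually_ge_atTop 1] with T hT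
    refine intervalIntegral.norm_integral_le_of_norm_le_const fun x hx => ?_
    rw [uIoc_of_le zero_le_two] at hx
    have := hQb (ε * T) (by rw [abs_mul, hε, one_mul, abs_of_pos (by linarith)]; exact hT) x
      hx.1.le hx.2
    rwa [abs_mul, hε, one_mul] at this
  have hlow := hhor (-1) (by simp)
  have hup := hhor 1 (by simp)
  simp only [neg_one_mul, one_mul] at hlow hup
  have hQ0 : ∀ y : ℝ, Q ((0 : ℝ) + y * I) =
      (fun s => P s - P 1) (y * I) * (cexp (y * I * w) / Complex.cosh (Real.pi * y / 2)) := by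
    intro y
    rw [ofReal_zero, zero_add, hQne _ (by intro h; simpa using congrArg re h)]
    simp only [hcf]
    rw [show (Real.pi * (y * I) / 2 : ℂ) = Real.pi * y / 2 * I by ring, Complex.cos_mul_I]
  -- Moving from `Re s = 0` to `Re s = 2` shifts the argument of cos by `π`; this sign is why the
  -- two transforms are added in the conclusion.
  have hQ2 : ∀ y : ℝ, Q ((2 : ℝ) + y * I) =
      -cexp (2 * w) * ((fun s => P (s + 2) - P 1) (y * I) *
        (cexp (y * I * w) / Complex.cosh (Real.pi * y / 2))) := by
    intro y
    rw [hQne _ (by intro h; simpa using congrArg re h)]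
    simp only [hcf, ofReal_ofNat]
    rw [show (Real.pi * (2 + y * I) / 2 : ℂ) = Real.pi * y / 2 * I + Real.pi by ring,
      Complex.cos_add_pi, Complex.cos_mul_I, add_mul, Complex.exp_add, add_comm (2 : ℂ)]
    ring
  have hPs : PolyGrowth fun s => P (s + 2) := by
    simpa using hP.shift (r := 2) zero_le_two
  have i0 := hP.integrable hw
  have i2 := hPs.integrable hw
  have i1 := (polyGrowth_const (P 1)).integrable hw
  have v0 : ∫ y : ℝ, Q ((0 : ℝ) + y * I) = sechTransform P w - P 1 * (2 / Complex.cosh w) := by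
    rw [← sechTransform_const _ hw, sechTransform, sechTransform, ← integral_sub i0 i1]
    exact integral_congr_ae (Eventually.of_forall fun y => by simp only [hQ0]; ring)
  have v2 : ∫ y : ℝ, Q ((2 : ℝ) + y * I) = -cexp (2 * w) *
      (sechTransform (fun s => P (s + 2)) w - P 1 * (2 / Complex.cosh w)) := by
    rw [← sechTransform_const _ hw, sechTransform, sechTransform, ← integral_sub i2 i1,
      ← integral_const_mul]
    exact integral_congr_ae (Eventually.of_forall fun y => by simp only [hQ2]; ring)
  have j0 : Integrable fun y : ℝ => Q ((0 : ℝ) + y * I) := by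
    refine (i0.sub i1).congr (Eventually.of_forall fun y => ?_)
    simp only [hQ0, Pi.sub_apply]; ring
  have j2 : Integrable fun y : ℝ => Q ((2 : ℝ) + y * I) := by
    refine ((i2.sub i1).const_mul (-cexp (2 * w))).congr (Eventually.of_forall fun y => ?_)
    simp only [hQ2, Pi.sub_apply]; ring
  have t0 := intervalIntegral_tendsto_integral j0 tendsto_neg_atTop_atBot tendsto_id
  have t2 := intervalIntegral_tendsto_integral j2 tendsto_neg_atTop_atBot tendsto_id
  have tt := ((hlow.sub hup).add (t2.const_smul I)).sub (t0.const_smul I)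
  have hz := tendsto_nhds_unique tt
    ((tendsto_const_nhds (x := (0 : ℂ))).congr fun T => (hrect T).symm)
  rw [v0, v2] at hz
  have hz' : sechTransform P w - P 1 * (2 / Complex.cosh w) = -cexp (2 * w) *
      (sechTransform (fun s => P (s + 2)) w - P 1 * (2 / Complex.cosh w)) := by
    simp only [smul_eq_mul, sub_zero, zero_add, ← mul_sub] at hz
    exact (sub_eq_zero.1 ((mul_eq_zero.1 hz).resolve_left I_ne_zero)).symm
  have hcosh : (1 + cexp (2 * w)) * (2 / Complex.cosh w) = 4 * cexp w := by
    have h0 := cosh_ne_zero_of_abs_im_lt hw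
    rw [mul_div_assoc', div_eq_iff h0, Complex.cosh, mul_div_assoc', eq_div_iff two_ne_zero]
    rw [two_mul w, Complex.exp_add, mul_add, mul_assoc 4, mul_assoc 4 _ (cexp (-w)),
      ← Complex.exp_add w (-w), add_neg_cancel, Complex.exp_zero]
    ring
  linear_combination hz' + P 1 * hcosh

/-- Each further shift by 2 crosses exactly one pole, at the next odd integer. -/
theorem PolyGrowth.sechTransform_eq_sum_add {P : ℂ → ℂ} (hP : PolyGrowth P) {w : ℂ}
    (hw : |w.im| < Real.pi / 2) (N : ℕ) :
    sechTransform P w = (∑ j ∈ Finset.range N,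
        4 * ((-1) ^ j * cexp ((2 * j + 1) * w) * P (2 * j + 1))) +
      (-1) ^ N * cexp (2 * N * w) * sechTransform (fun s => P (s + (2 * N : ℝ))) w := by
  induction N with
  | zero => simp
  | succ N ih =>
    have h := (hP.shift (r := 2 * N) (by positivity)).sechTransform_add_shift hw
    have e : (fun s : ℂ => P (s + 2 + ((2 * N : ℝ) : ℂ))) =
        fun s : ℂ => P (s + ((2 * (N + 1 : ℕ) : ℝ) : ℂ)) := by
      ext s; congr 1; push_cast; ring
    rw [e] at h
    have e1 : cexp (2 * (N + 1 : ℕ) * w) = cexp (2 * N * w) * cexp (2 * w) := by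
      rw [← Complex.exp_add]; push_cast; ring_nf
    have e2 : cexp ((2 * N + 1) * w) = cexp (2 * N * w) * cexp w := by
      rw [← Complex.exp_add]; ring_nf
    have e3 : (1 : ℂ) + ((2 * N : ℝ) : ℂ) = 2 * N + 1 := by push_cast; ring
    rw [e3] at h
    rw [ih, Finset.sum_range_succ, e1, e2, pow_succ]
    linear_combination (-1) ^ N * cexp (2 * N * w) * h

theorem summable_pow_mul_geometric (a b : ℝ) {r : ℝ} (h0 : 0 ≤ r) (h1 : r < 1) (M : ℕ) :
    Summable fun j : ℕ => (a * j + b) ^ M * r ^ j := by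
  have hr : ‖r‖ < 1 := by rwa [Real.norm_of_nonneg h0]
  have : ∀ j : ℕ, (a * j + b) ^ M * r ^ j = ∑ i ∈ Finset.range (M + 1),
      (a ^ i * b ^ (M - i) * (M.choose i)) * ((j : ℝ) ^ i * r ^ j) := by
    intro j
    rw [add_pow, Finset.sum_mul]
    refine Finset.sum_congr rfl fun i _ => ?_
    rw [mul_pow]; ring
  simp_rw [this]
  exact summable_sum fun i _ => (summable_pow_mul_geometric_of_norm_lt_one i hr).mul_left _

/-- Closing the contour to the right: the residue series of `sechTransform`. -/
theorem PolyGrowth.hasSum_sechTransform {P : ℂ → ℂ} (hP : PolyGrowth P) {w : ℂ}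
    (hw : |w.im| < Real.pi / 2) (hre : w.re < 0) :
    HasSum (fun j : ℕ => 4 * ((-1) ^ j * cexp ((2 * j + 1) * w) * P (2 * j + 1)))
      (sechTransform P w) := by
  obtain ⟨C, M, hC, hb⟩ := hP.bound
  set r : ℝ := Real.exp (2 * w.re) with hr
  have hr0 : 0 ≤ r := (Real.exp_pos _).le
  have hr1 : r < 1 := Real.exp_lt_one_iff.2 (by linarith)
  have hN : ∀ N : ℕ, ‖cexp (2 * N * w)‖ = r ^ N := by
    intro N
    rw [norm_exp, hr, ← Real.exp_nat_mul]
    congr 1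
    rw [show (2 * N * w : ℂ) = ((N * 2 : ℝ) : ℂ) * w by push_cast; ring, re_ofReal_mul]
    ring
  have hsum : Summable fun j : ℕ => 4 * ((-1) ^ j * cexp ((2 * j + 1) * w) * P (2 * j + 1)) := by
    refine Summable.of_norm_bounded
      (((summable_pow_mul_geometric 2 2 hr0 hr1 M).mul_left (4 * ‖cexp w‖ * C))) fun j => ?_
    have e2 : cexp ((2 * j + 1) * w) = cexp (2 * j * w) * cexp w := by
      rw [← Complex.exp_add]; ring_nf
    have e3 : (2 * j + 1 : ℂ) = ((2 * j + 1 : ℝ) : ℂ) := by push_cast; rfl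
    have h1 := hb ((2 * j + 1 : ℝ) : ℂ) (by rw [ofReal_re]; positivity)
    rw [norm_real, Real.norm_of_nonneg (by positivity)] at h1
    rw [e2, norm_mul, norm_mul, norm_mul, norm_pow, norm_neg, norm_one, one_pow, one_mul, norm_mul,
      hN, e3, Complex.norm_ofNat]
    calc 4 * (r ^ j * ‖cexp w‖ * ‖P ((2 * j + 1 : ℝ) : ℂ)‖)
        ≤ 4 * (r ^ j * ‖cexp w‖ * (C * (1 + (2 * j + 1)) ^ M)) := by gcongr
      _ = _ := by rw [show (1 + (2 * j + 1) : ℝ) = 2 * j + 2 by ring]; ring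
  refine (hsum.hasSum_iff_tendsto_nat).2 ?_
  set J : ℝ := ∫ t : ℝ, (1 + |t|) ^ M * Real.exp (-(Real.pi / 2 - |w.im|) * |t|) with hJ
  have hJ0 : 0 ≤ J := integral_nonneg fun t => by positivity
  -- Since `Re w < 0`, the factor `e^(2Nw)` decays geometrically, while the shifted `P` costs only a
  -- power of `2N + 1`.
  have hrem : Tendsto (fun N : ℕ => (-1) ^ N * cexp (2 * N * w) *
      sechTransform (fun s => P (s + (2 * N : ℝ))) w) atTop (𝓝 0) := by
    have hlim := ((summable_pow_mul_geometric 2 1 hr0 hr1 M).mul_left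
      (2 * C * J)).tendsto_atTop_zero
    refine squeeze_zero_norm (fun N => ?_) hlim
    rw [norm_mul, norm_mul, norm_pow, norm_neg, norm_one, one_pow, one_mul, hN]
    have hb' : ∀ s : ℂ, 0 ≤ s.re → ‖P (s + (2 * N : ℝ))‖ ≤
        (C * (2 * N + 1) ^ M) * (1 + ‖s‖) ^ M := by
      intro s hs
      refine (hb _ (by simp; positivity)).trans ?_
      rw [mul_assoc, ← mul_pow]
      have : ‖s + (2 * N : ℝ)‖ ≤ ‖s‖ + 2 * N := by
        refine (norm_add_le _ _).trans ?_
        rw [norm_real, Real.norm_of_nonneg (by positivity)]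
      gcongr
      nlinarith [norm_nonneg s, mul_nonneg (Nat.cast_nonneg (α := ℝ) N) (norm_nonneg s)]
    have h2 : ‖sechTransform (fun s => P (s + (2 * N : ℝ))) w‖ ≤
        2 * (C * (2 * N + 1) ^ M) * J := by
      rw [hJ, ← integral_const_mul]
      exact norm_integral_le_of_norm_le
        ((integrable_one_add_abs_pow_mul_exp (sub_pos.2 hw) M).const_mul _)
        (Eventually.of_forall fun t =>
          norm_sechTransform_integrand_le (by positivity) hb' w t)
    calc r ^ N * _ ≤ r ^ N * (2 * (C * (2 * N + 1) ^ M) * J) := by gcongr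
      _ = _ := by ring
  have := (tendsto_const_nhds (x := sechTransform P w)).sub hrem
  rw [sub_zero] at this
  refine this.congr fun N => ?_
  rw [hP.sechTransform_eq_sum_add hw N]
  ring

/-! ### Holomorphy of the transform in the strip. -/

theorem isOpen_strip : IsOpen {w : ℂ | |w.im| < Real.pi / 2} :=
  isOpen_lt (by fun_prop) continuous_const

theorem isPreconnected_strip : IsPreconnected {w : ℂ | |w.im| < Real.pi / 2} := by
  have : {w : ℂ | |w.im| < Real.pi / 2} =
      Complex.imCLM ⁻¹' (Ioo (-(Real.pi / 2)) (Real.pi / 2)) := by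
    ext w; simp [abs_lt]
  rw [this]
  exact ((convex_Ioo _ _).linear_preimage (imCLM : ℂ →L[ℝ] ℝ).toLinearMap).isPreconnected

/-- `sechTransform P` is holomorphic in the strip. -/
theorem PolyGrowth.differentiableOn_sechTransform {P : ℂ → ℂ} (hP : PolyGrowth P) :
    DifferentiableOn ℂ (sechTransform P) {w : ℂ | |w.im| < Real.pi / 2} := by
  intro w hw
  obtain ⟨C, M, hC, hb⟩ := hP.bound
  -- On a ball of radius half the distance to the edge of the strip, decay at rate `c` survives; the
  -- factor `it` from differentiation accounts for the exponent `M + 1`.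
  have hw' : 0 < (Real.pi / 2 - |w.im|) / 2 := half_pos (sub_pos.2 hw)
  set c := (Real.pi / 2 - |w.im|) / 2 with hc
  have him : ∀ z ∈ Metric.ball w c, |z.im| ≤ |w.im| + c := by
    intro z hz
    rw [mem_ball_iff_norm] at hz
    have h1 : |z.im - w.im| ≤ ‖z - w‖ := by simpa using abs_im_le_norm (z - w)
    have h2 := abs_sub_abs_le_abs_sub z.im w.im
    linarith
  have key := hasDerivAt_integral_of_dominated_loc_of_deriv_le (μ := volume) (𝕜 := ℂ)
    (F := fun z (t : ℝ) => P (t * I) * (cexp (t * I * z) / Complex.cosh (Real.pi * t / 2)))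
    (F' := fun z (t : ℝ) => P (t * I) * (cexp (t * I * z) * (t * I) /
      Complex.cosh (Real.pi * t / 2)))
    (x₀ := w) (s := Metric.ball w c)
    (bound := fun t => 2 * C * ((1 + |t|) ^ (M + 1) * Real.exp (-c * |t|)))
    (Metric.ball_mem_nhds w hw')
    (Eventually.of_forall fun z =>
      (hP.continuous_mul_I.mul (continuous_exp_div_cosh z)).aestronglyMeasurable)
    (hP.integrable hw)
    (hP.continuous_mul_I.mul (Continuous.div (by fun_prop) (by fun_prop)
      cosh_pi_mul_div_two_ne_zero)).aestronglyMeasurable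
    (Eventually.of_forall fun t z hz => ?_)
    ((integrable_one_add_abs_pow_mul_exp hw' _).const_mul _)
    (Eventually.of_forall fun t z hz => ?_)
  · exact key.2.differentiableAt.differentiableWithinAt
  · have h1 := norm_sechTransform_integrand_le hC hb z t
    rw [show P (t * I) * (cexp (t * I * z) * (t * I) / Complex.cosh (Real.pi * t / 2)) =
      P (t * I) * (cexp (t * I * z) / Complex.cosh (Real.pi * t / 2)) * (t * I) by ring,
      norm_mul, norm_ofReal_mul_I]
    have h2 : Real.exp (-(Real.pi / 2 - |z.im|) * |t|) ≤ Real.exp (-c * |t|) := by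
      rw [Real.exp_le_exp]
      have := him z hz
      have h3 : c ≤ Real.pi / 2 - |z.im| := by linarith
      nlinarith [abs_nonneg t]
    calc _ ≤ 2 * C * ((1 + |t|) ^ M * Real.exp (-(Real.pi / 2 - |z.im|) * |t|)) * (1 + |t|) := by
          gcongr
          linarith
      _ ≤ 2 * C * ((1 + |t|) ^ M * Real.exp (-c * |t|)) * (1 + |t|) := by gcongr
      _ = _ := by ring
  · have h1 : HasDerivAt (fun z : ℂ => t * I * z) (t * I) z := by
      simpa using (hasDerivAt_id z).const_mul (t * I : ℂ)
    exact (h1.cexp.div_const _).const_mul _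

/-! ### Natural exponents: the Lerch function is rational. -/

/-- `∑ (v + n) ^ k z ^ n` is the polynomial `lerchPoly v k` evaluated at `1 / (1 - z)`. -/
noncomputable def lerchPoly (v : ℂ) : ℕ → Polynomial ℂ
  | 0 => Polynomial.X
  | k + 1 => (Polynomial.X ^ 2 - Polynomial.X) * (lerchPoly v k).derivative +
      Polynomial.C v * lerchPoly v k

noncomputable def lerchRat (v : ℂ) (k : ℕ) (z : ℂ) : ℂ := (lerchPoly v k).eval (1 / (1 - z))

theorem hasDerivAt_lerchRat (v : ℂ) (k : ℕ) {z : ℂ} (hz : z ≠ 1) :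
    HasDerivAt (lerchRat v k)
      ((lerchPoly v k).derivative.eval (1 / (1 - z)) * (1 / (1 - z)) ^ 2) z := by
  have h1 : (1 : ℂ) - z ≠ 0 := sub_ne_zero.2 hz.symm
  have h2 : HasDerivAt (fun z : ℂ => 1 / (1 - z)) ((1 / (1 - z)) ^ 2) z := by
    have := ((hasDerivAt_id z).const_sub 1).inv h1
    simp only [one_div]
    refine this.congr_deriv ?_
    simp
  exact ((lerchPoly v k).hasDerivAt _).comp z h2

/-- The operator `z d/dz + v` multiplies the `n`-th coefficient by `v + n`. For `x = 1/(1 - z)` one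
has `z d/dz = (x² - x) d/dx`, which is the recursion of `lerchPoly`. -/
theorem lerchRat_succ (v : ℂ) (k : ℕ) {z : ℂ} (hz : z ≠ 1) :
    lerchRat v (k + 1) z = z * deriv (lerchRat v k) z + v * lerchRat v k z := by
  have h1 : (1 : ℂ) - z ≠ 0 := sub_ne_zero.2 hz.symm
  rw [(hasDerivAt_lerchRat v k hz).deriv, lerchRat, lerchPoly, lerchRat]
  simp only [Polynomial.eval_add, Polynomial.eval_mul, Polynomial.eval_sub, Polynomial.eval_pow,
    Polynomial.eval_X, Polynomial.eval_C]
  have : (1 / (1 - z)) ^ 2 - 1 / (1 - z) = z * (1 / (1 - z)) ^ 2 := by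
    field_simp; ring
  rw [this]; ring

theorem hasSum_lerchRat (v : ℂ) (k : ℕ) {z : ℂ} (hz : ‖z‖ < 1) :
    HasSum (fun n : ℕ => (v + n) ^ k * z ^ n) (lerchRat v k z) := by
  induction k generalizing z with
  | zero => simpa [lerchRat, lerchPoly] using hasSum_geometric_of_norm_lt_one hz
  | succ k ih =>
    obtain ⟨r, hr1, hr2⟩ := exists_between hz
    have hr0 : 0 ≤ r := (norm_nonneg z).trans hr1.le
    have hz1 : z ≠ 1 := by rintro rfl; simp at hz
    have hzmem : z ∈ Metric.ball (0 : ℂ) r := by simpa using hr1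
    have hd := hasSum_deriv_of_summable_norm (F := fun (n : ℕ) (z : ℂ) => (v + n) ^ k * z ^ n)
      (U := Metric.ball 0 r) (summable_pow_mul_geometric 1 ‖v‖ hr0 hr2 k)
      (fun n => by fun_prop) Metric.isOpen_ball (fun n w hw => ?_) hzmem
    · have he : (fun w : ℂ => ∑' n : ℕ, (v + n) ^ k * w ^ n) =ᶠ[𝓝 z] lerchRat v k := by
        filter_upwards [Metric.isOpen_ball.mem_nhds hzmem] with w hw
        rw [mem_ball_zero_iff] at hw
        exact (ih (hw.trans hr2)).tsum_eq
      rw [he.deriv_eq] at hd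
      rw [lerchRat_succ v k hz1]
      refine ((hd.mul_left z).add ((ih hz).mul_left v)).congr_fun ?_
      intro n
      have : deriv (fun z : ℂ => (v + n) ^ k * z ^ n) z = (v + n) ^ k * (n * z ^ (n - 1)) := by
        rw [deriv_const_mul_field, deriv_pow_field]
      rw [this, pow_succ]
      rcases n with _ | n
      · simp; ring
      · rw [Nat.add_sub_cancel]; ring
    · rw [mem_ball_zero_iff] at hw
      rw [norm_mul, norm_pow, norm_pow]
      have : ‖v + n‖ ≤ 1 * n + ‖v‖ := by
        rw [one_mul, add_comm]
        exact (norm_add_le _ _).trans (by simp)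
      gcongr

theorem isLerchBranch_lerchRat (v : ℂ) (k : ℕ) : IsLerchBranch (-k) v (lerchRat v k) := by
  refine ⟨fun z hz => ?_, fun z hz => ?_⟩
  · have : z ≠ 1 := by rintro rfl; exact hz (by simp)
    exact (hasDerivAt_lerchRat v k this).differentiableAt.differentiableWithinAt
  · refine (hasSum_lerchRat v k hz).congr_fun fun n => ?_
    -- These rewrites remain valid when `v + n = 0`: the term is then read as `z^n · 0^k`.
    rw [cpow_neg, cpow_natCast, div_inv_eq_mul, mul_comm]

/-- Here the continuous extension in `lerchPhi` matters: for non-real `α` the arguments `-e^(2w)`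
may land on the cut, and only the pole has to be avoided. -/
theorem lerchPhi_neg_natCast (v : ℂ) (k : ℕ) {z : ℂ} (hz : z ≠ 1) :
    lerchPhi z (-k) v = lerchRat v k z :=
  (isLerchBranch_lerchRat v k).lerchPhi_eq_of_tendsto
    (hasDerivAt_lerchRat v k hz).continuousAt.continuousWithinAt

/-- The absence of a constant term makes `lerchRat` vanish at infinity like `1/(1 - z)`, which the
decay for `Re w → +∞` requires. -/
theorem X_dvd_lerchPoly (v : ℂ) (k : ℕ) : Polynomial.X ∣ lerchPoly v k := by
  induction k with
  | zero => exact dvd_rfl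
  | succ k ih =>
    refine dvd_add (Dvd.dvd.mul_right ?_ _) (ih.mul_left _)
    exact dvd_sub (dvd_pow_self _ two_ne_zero) dvd_rfl

theorem exists_norm_lerchPoly_eval_le (v : ℂ) (k : ℕ) :
    ∃ C : ℝ, 0 ≤ C ∧ ∀ x : ℂ, ‖x‖ ≤ 2 → ‖(lerchPoly v k).eval x‖ ≤ C * ‖x‖ := by
  obtain ⟨R, hR⟩ := X_dvd_lerchPoly v k
  obtain ⟨C, hC⟩ := (isCompact_closedBall (0 : ℂ) 2).exists_bound_of_continuousOn
    (f := fun x => R.eval x) R.continuous.continuousOn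
  refine ⟨C, (norm_nonneg _).trans (hC 0 (by simp)), fun x hx => ?_⟩
  rw [hR, Polynomial.eval_mul, Polynomial.eval_X, norm_mul, mul_comm]
  gcongr
  exact hC x (by simpa using hx)

theorem exp_mul_one_div_one_add_exp {w : ℂ} :
    cexp w * (1 / (1 - -cexp (2 * w))) = 1 / (2 * Complex.cosh w) := by
  have h : 1 - -cexp (2 * w) = cexp w * (2 * Complex.cosh w) := by
    rw [Complex.cosh, mul_div_cancel₀ _ two_ne_zero, mul_add, ← Complex.exp_add,
      ← Complex.exp_add, add_neg_cancel, Complex.exp_zero]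
    ring_nf
  rw [h]
  have := Complex.exp_ne_zero w
  by_cases h0 : Complex.cosh w = 0
  · simp [h0]
  · field_simp

theorem neg_exp_two_mul_ne_one {w : ℂ} (hw : Complex.cosh w ≠ 0) : -cexp (2 * w) ≠ 1 := by
  intro h
  apply hw
  have h1 : cexp (-w) = -cexp w := by
    rw [Complex.exp_neg]
    apply inv_eq_of_mul_eq_one_right
    rw [mul_neg, ← Complex.exp_add, ← two_mul, h]
  rw [Complex.cosh, h1]
  simp

/-- One factor `1/(1 + e^(2w))` combines with `e^w` into `sech w / 2`. The rest is a polynomial in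
`1/(1 + e^(2w))`, which stays in the disc of radius 2 once `|Re w| ≥ 1`. -/
theorem exists_norm_exp_mul_lerchRat_le (v : ℂ) (k : ℕ) :
    ∃ C : ℝ, 0 ≤ C ∧ ∀ w : ℂ, 1 ≤ |w.re| →
      ‖cexp w * lerchRat v k (-cexp (2 * w))‖ ≤ C * Real.exp (-|w.re|) := by
  obtain ⟨C, hC, h⟩ := exists_norm_lerchPoly_eval_le v k
  refine ⟨C * 2, by positivity, fun w hw => ?_⟩
  have hx : ‖1 / (1 - -cexp (2 * w))‖ ≤ 2 := by
    have hn : ‖cexp (2 * w)‖ = Real.exp (2 * w.re) := by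
      rw [norm_exp, show (2 : ℂ) = ((2 : ℝ) : ℂ) by simp, re_ofReal_mul]
    have h12 : 1 / 2 ≤ ‖1 - -cexp (2 * w)‖ := by
      rw [sub_neg_eq_add]
      have e2 : (2 : ℝ) + 1 ≤ Real.exp 2 := Real.add_one_le_exp 2
      rcases le_abs.1 hw with h1 | h1
      · have h2 := norm_sub_norm_le (cexp (2 * w)) (-1)
        rw [norm_neg, norm_one, hn, sub_neg_eq_add, add_comm _ (1 : ℂ)] at h2
        have : Real.exp 2 ≤ Real.exp (2 * w.re) := Real.exp_le_exp.2 (by linarith)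
        linarith
      · have h2 := norm_sub_norm_le 1 (-cexp (2 * w))
        rw [norm_neg, norm_one, hn, sub_neg_eq_add] at h2
        have h3 : Real.exp (2 * w.re) ≤ Real.exp (-2) := Real.exp_le_exp.2 (by linarith)
        have h4 : Real.exp (-2) ≤ 1 / 2 := by
          rw [Real.exp_neg, inv_eq_one_div]
          exact one_div_le_one_div_of_le two_pos (by linarith)
        linarith
    rw [norm_div, norm_one, div_le_iff₀ (by linarith)]
    linarith
  have hcosh := exp_abs_re_le_norm_cosh hw
  have hc0 : 0 < ‖Complex.cosh w‖ := by linarith [Real.exp_pos |w.re|]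
  rw [norm_mul]
  calc ‖cexp w‖ * ‖lerchRat v k (-cexp (2 * w))‖
      ≤ ‖cexp w‖ * (C * ‖1 / (1 - -cexp (2 * w))‖) := by gcongr; exact h _ hx
    _ = C * ‖cexp w * (1 / (1 - -cexp (2 * w)))‖ := by rw [norm_mul]; ring
    _ = C * (1 / (2 * ‖Complex.cosh w‖)) := by
        rw [exp_mul_one_div_one_add_exp, norm_div, norm_mul]; simp
    _ ≤ C * (2 * Real.exp (-|w.re|)) := by
        gcongr
        rw [Real.exp_neg, div_le_iff₀ (by positivity), ← div_eq_mul_inv, div_mul_eq_mul_div,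
          le_div_iff₀ (Real.exp_pos _)]
        linarith
    _ = _ := by ring

/-! ### Continuation to the cut plane through the transform. -/

/-- `F` continues `∑ P (2 n + 1) z ^ n` to the cut plane. -/
def IsOddContinuation (P F : ℂ → ℂ) : Prop :=
  DifferentiableOn ℂ F lerchCutPlane ∧
    ∀ z : ℂ, ‖z‖ < 1 → HasSum (fun n : ℕ => P (2 * n + 1) * z ^ n) (F z)

theorem log_exp_two_mul {w : ℂ} (h : |w.im| < Real.pi / 2) :
    Complex.log (cexp (2 * w)) = 2 * w := by
  obtain ⟨h1, h2⟩ := abs_lt.1 h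
  have him : (2 * w).im = 2 * w.im := by
    rw [show (2 : ℂ) = ((2 : ℝ) : ℂ) by simp, im_ofReal_mul]
  exact Complex.log_exp (by rw [him]; linarith) (by rw [him]; linarith)

theorem neg_exp_mem_lerchCutPlane {w : ℂ} (h : |w.im| < Real.pi / 2) :
    -cexp (2 * w) ∈ lerchCutPlane := by
  rintro ⟨him, hre⟩
  rw [neg_im, neg_eq_zero] at him
  rw [neg_re] at hre
  have h1 : cexp (2 * w) = (((cexp (2 * w)).re : ℝ) : ℂ) := by
    apply Complex.ext <;> simp [him]
  have h2 : (Complex.log (cexp (2 * w))).im = Real.pi := by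
    rw [h1, log_im, arg_ofReal_of_neg (by linarith)]
  rw [log_exp_two_mul h, show (2 : ℂ) = ((2 : ℝ) : ℂ) by simp, im_ofReal_mul] at h2
  obtain ⟨h3, h4⟩ := abs_lt.1 h
  linarith

theorem norm_exp_two_mul (w : ℂ) : ‖cexp (2 * w)‖ = Real.exp (2 * w.re) := by
  rw [norm_exp, show (2 : ℂ) = ((2 : ℝ) : ℂ) by simp, re_ofReal_mul]

theorem PolyGrowth.exp_mul_eq_sechTransform_of_neg {P : ℂ → ℂ} (hP : PolyGrowth P) {w y : ℂ}
    (hw : |w.im| < Real.pi / 2) (hre : w.re < 0)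
    (hy : HasSum (fun n : ℕ => P (2 * n + 1) * (-cexp (2 * w)) ^ n) y) :
    cexp w * y = 1 / 4 * sechTransform P w := by
  refine (hy.mul_left (cexp w)).unique
    (((hP.hasSum_sechTransform hw hre).mul_left (1 / 4)).congr_fun fun n => ?_)
  rw [neg_pow, ← Complex.exp_nat_mul, show ((2 * n + 1) * w : ℂ) = w + n * (2 * w) by ring,
    Complex.exp_add]
  ring

/-- The residue series proves this for `Re w < 0`; the identity theorem carries it across the strip.
-/
theorem PolyGrowth.exp_mul_eq_sechTransform {P F : ℂ → ℂ} (hP : PolyGrowth P)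
    (hF : IsOddContinuation P F) {w : ℂ} (hw : |w.im| < Real.pi / 2) :
    cexp w * F (-cexp (2 * w)) = 1 / 4 * sechTransform P w := by
  have hd : DifferentiableOn ℂ (fun w => cexp w * F (-cexp (2 * w)))
      {w : ℂ | |w.im| < Real.pi / 2} :=
    DifferentiableOn.mul (by fun_prop)
      (hF.1.comp (by fun_prop) fun w hw => neg_exp_mem_lerchCutPlane hw)
  refine (hd.analyticOnNhd isOpen_strip).eqOn_of_preconnected_of_eventuallyEq
    ((hP.differentiableOn_sechTransform.const_mul (1 / 4)).analyticOnNhd isOpen_strip)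
    isPreconnected_strip (z₀ := -1) (by simp [Real.pi_pos]) ?_ hw
  have hopen : IsOpen {w : ℂ | w.re < 0} := isOpen_lt continuous_re continuous_const
  filter_upwards [isOpen_strip.mem_nhds (show (-1 : ℂ) ∈ _ by simp [Real.pi_pos]),
    hopen.mem_nhds (show (-1 : ℂ) ∈ _ by simp)] with w hw hre
  refine hP.exp_mul_eq_sechTransform_of_neg hw hre (hF.2 _ ?_)
  rw [norm_neg, norm_exp_two_mul]
  exact Real.exp_lt_one_iff.2 (by linarith [show w.re < 0 from hre])

theorem PolyGrowth.summable_odd {P : ℂ → ℂ} (hP : PolyGrowth P) {r : ℝ} (h0 : 0 ≤ r)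
    (h1 : r < 1) : Summable fun n : ℕ => ‖P (2 * n + 1)‖ * r ^ n := by
  obtain ⟨C, M, hC, hb⟩ := hP.bound
  refine Summable.of_nonneg_of_le (fun n => by positivity) (fun n => ?_)
    ((summable_pow_mul_geometric 2 2 h0 h1 M).mul_left C)
  have e3 : (2 * n + 1 : ℂ) = ((2 * n + 1 : ℝ) : ℂ) := by push_cast; rfl
  have h := hb ((2 * n + 1 : ℝ) : ℂ) (by rw [ofReal_re]; positivity)
  rw [norm_real, Real.norm_of_nonneg (by positivity)] at h
  rw [e3]
  calc _ ≤ (C * (1 + (2 * n + 1)) ^ M) * r ^ n := by gcongr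
    _ = _ := by rw [show (1 + (2 * n + 1) : ℝ) = 2 * n + 2 by ring]; ring

/-- The transform itself supplies the continuation. With `W = log(-z)/2`, the function `e^(-W)
T(W)/4` is holomorphic off `[0, ∞)` and agrees with the power series in the disc. The disc covers
`[0, 1)`, so the two pieces together cover the cut plane. -/
theorem PolyGrowth.exists_isOddContinuation {P : ℂ → ℂ} (hP : PolyGrowth P) :
    ∃ F, IsOddContinuation P F := by
  classical
  set S : ℂ → ℂ := fun z => ∑' n : ℕ, P (2 * n + 1) * z ^ n with hS
  set W : ℂ → ℂ := fun z => Complex.log (-z) / 2 with hW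
  set G : ℂ → ℂ := fun z => cexp (-W z) * (1 / 4 * sechTransform P (W z)) with hG
  have hsum : ∀ z : ℂ, ‖z‖ < 1 → HasSum (fun n : ℕ => P (2 * n + 1) * z ^ n) (S z) := by
    intro z hz
    refine Summable.hasSum (Summable.of_norm ?_)
    simpa using hP.summable_odd (norm_nonneg z) hz
  have hSd : ∀ z : ℂ, ‖z‖ < 1 → DifferentiableAt ℂ S z := by
    intro z hz
    obtain ⟨r, hr1, hr2⟩ := exists_between hz
    have hr0 : 0 ≤ r := (norm_nonneg z).trans hr1.le
    refine (differentiableOn_tsum_of_summable_norm (U := Metric.ball 0 r)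
      (hP.summable_odd hr0 hr2) (fun n => by fun_prop) Metric.isOpen_ball
      fun n w hw => ?_).differentiableAt (Metric.isOpen_ball.mem_nhds (by simpa using hr1))
    rw [mem_ball_zero_iff] at hw
    rw [norm_mul, norm_pow]
    gcongr
  have hWim : ∀ z : ℂ, -z ∈ slitPlane → |(W z).im| < Real.pi / 2 := by
    intro z hz
    have h1 : (W z).im = arg (-z) / 2 := by
      simp only [hW]
      rw [show (2 : ℂ) = ((2 : ℝ) : ℂ) by simp, div_ofReal_im, log_im]
    have h2 := mem_slitPlane_iff_arg.1 hz
    rw [h1, abs_lt]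
    have h3 := neg_pi_lt_arg (-z)
    have h4 := lt_of_le_of_ne (arg_le_pi (-z)) h2.1
    constructor <;> linarith
  have hWexp : ∀ z : ℂ, -z ∈ slitPlane → -cexp (2 * W z) = z := by
    intro z hz
    simp only [hW]
    rw [mul_div_cancel₀ _ two_ne_zero, Complex.exp_log (slitPlane_ne_zero hz), neg_neg]
  have hagree : ∀ z : ℂ, -z ∈ slitPlane → ‖z‖ < 1 → G z = S z := by
    intro z hz hz1
    have h1 := hWexp z hz
    have hre : (W z).re < 0 := by
      rw [← h1, norm_neg, norm_exp_two_mul, Real.exp_lt_one_iff] at hz1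
      linarith
    have h2 := hP.exp_mul_eq_sechTransform_of_neg (y := S z) (hWim z hz) hre
      (by rw [h1]; exact hsum z (by rwa [← h1] at hz1 ⊢))
    simp only [hG]
    rw [← h2, ← mul_assoc, ← Complex.exp_add, neg_add_cancel, Complex.exp_zero, one_mul]
  have hGd : ∀ z : ℂ, -z ∈ slitPlane → DifferentiableAt ℂ G z := by
    intro z hz
    have hWd : DifferentiableAt ℂ W z := by
      refine DifferentiableAt.div_const ?_ 2
      exact (differentiableAt_id.neg).clog hz
    exact hWd.neg.cexp.mul (((hP.differentiableOn_sechTransform.differentiableAt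
      (isOpen_strip.mem_nhds (hWim z hz))).comp z hWd).const_mul _)
  have hball : IsOpen {z : ℂ | ‖z‖ < 1} := isOpen_lt continuous_norm continuous_const
  refine ⟨fun z => if ‖z‖ < 1 then S z else G z, fun z hz => ?_, fun z hz => ?_⟩
  · refine DifferentiableAt.differentiableWithinAt ?_
    by_cases h : ‖z‖ < 1
    · refine (hSd z h).congr_of_eventuallyEq ?_
      filter_upwards [hball.mem_nhds h] with y hy
      exact if_pos hy
    · have hs : -z ∈ slitPlane := by
        rw [mem_slitPlane_iff, neg_re, neg_im]
        by_contra! hcon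
        have him : z.im = 0 := by simpa using hcon.2
        have hre : 0 ≤ z.re := by linarith [hcon.1]
        have hzr : z = (z.re : ℂ) := by apply Complex.ext <;> simp [him]
        apply hz
        refine ⟨him, ?_⟩
        rw [hzr, norm_real, Real.norm_of_nonneg hre, not_lt] at h
        exact h
      refine (hGd z hs).congr_of_eventuallyEq ?_
      have hopen : IsOpen {z : ℂ | -z ∈ slitPlane} := isOpen_slitPlane.preimage continuous_neg
      filter_upwards [hopen.mem_nhds hs] with y hy
      split_ifs with h1
      · exact (hagree y hy h1).symm
      · rfl
  · simp only [if_pos hz]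
    exact hsum z hz

/-! ### The Lerch function as a sech transform of a power. -/

theorem half_mul_cpow (z k : ℂ) : (1 / 2 * z) ^ k = 2 ^ (-k) * z ^ k := by
  by_cases hz : z = 0
  · subst hz
    by_cases hk : k = 0
    · simp [hk]
    · simp [zero_cpow hk]
  · have h2 : (1 / 2 * z) = ((1 / 2 : ℝ) : ℂ) * z := by push_cast; ring
    have h3 : Complex.log (1 / 2 * z) = -Complex.log 2 + Complex.log z := by
      rw [h2, Complex.log_ofReal_mul (by norm_num) hz, one_div, Real.log_inv]
      simp
    rw [cpow_def_of_ne_zero (by simpa using hz), cpow_def_of_ne_zero hz,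
      cpow_def_of_ne_zero two_ne_zero, h3, ← Complex.exp_add]
    ring_nf

/-- For `v = (L + 1)/2` one has `v + n = (L + 2n + 1)/2`, and the positive factor `1/2` leaves
principal powers multiplicative. The constant is `2^(-k) · 1/4`. -/
theorem PolyGrowth.exp_mul_lerchPhi {L k : ℂ} (hP : PolyGrowth fun s => (L + s) ^ k) {w : ℂ}
    (hw : |w.im| < Real.pi / 2) :
    cexp w * lerchPhi (-cexp (2 * w)) (-k) (1 / 2 * (L + 1)) =
      2 ^ (-k - 2) * sechTransform (fun s => (L + s) ^ k) w := by
  obtain ⟨F, hF⟩ := hP.exists_isOddContinuation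
  have hB : IsLerchBranch (-k) (1 / 2 * (L + 1)) (fun z => 2 ^ (-k) * F z) := by
    refine ⟨hF.1.const_mul _, fun z hz => ((hF.2 z hz).mul_left _).congr_fun fun n => ?_⟩
    rw [cpow_neg, div_inv_eq_mul,
      show (1 / 2 * (L + 1) + n : ℂ) = 1 / 2 * (L + (2 * n + 1)) by ring, half_mul_cpow]
    ring
  rw [hB.lerchPhi_eq (neg_exp_mem_lerchCutPlane hw), mul_left_comm,
    hP.exp_mul_eq_sechTransform hF hw, cpow_sub _ _ two_ne_zero, cpow_ofNat]
  ring

theorem norm_add_le_one_add_mul (L s : ℂ) : ‖L + s‖ ≤ (1 + ‖L‖) * (1 + ‖s‖) := by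
  have := norm_add_le L s
  nlinarith [norm_nonneg L, norm_nonneg s, mul_nonneg (norm_nonneg L) (norm_nonneg s)]

/-- A negative exponent is harmless when `Re L > 0`, because then `‖L + s‖ ≥ Re L`. -/
theorem exists_norm_add_rpow_le {L : ℂ} {r : ℝ} (h : 0 ≤ r ∨ 0 < L.re) :
    ∃ C : ℝ, ∃ M : ℕ, 0 ≤ C ∧ ∀ s : ℂ, 0 ≤ s.re → ‖L + s‖ ^ r ≤ C * (1 + ‖s‖) ^ M := by
  rcases le_or_gt 0 r with hr | hr
  · refine ⟨(1 + ‖L‖) ^ ⌈r⌉₊, ⌈r⌉₊, by positivity, fun s _ => ?_⟩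
    have h1 : 1 ≤ (1 + ‖L‖) * (1 + ‖s‖) := by
      nlinarith [norm_nonneg L, norm_nonneg s, mul_nonneg (norm_nonneg L) (norm_nonneg s)]
    calc ‖L + s‖ ^ r ≤ ((1 + ‖L‖) * (1 + ‖s‖)) ^ r :=
          Real.rpow_le_rpow (norm_nonneg _) (norm_add_le_one_add_mul L s) hr
      _ ≤ ((1 + ‖L‖) * (1 + ‖s‖)) ^ (⌈r⌉₊ : ℝ) :=
          Real.rpow_le_rpow_of_exponent_le h1 (Nat.le_ceil r)
      _ = _ := by rw [Real.rpow_natCast, mul_pow]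
  · have hL : 0 < L.re := h.resolve_left (not_le.2 hr)
    refine ⟨L.re ^ r, 0, by positivity, fun s hs => ?_⟩
    rw [pow_zero, mul_one]
    refine Real.rpow_le_rpow_of_nonpos hL ?_ hr.le
    have := (le_abs_self _).trans (abs_re_le_norm (L + s))
    rw [add_re] at this
    linarith

theorem norm_cpow_le_exp_mul (z k : ℂ) :
    ‖z ^ k‖ ≤ Real.exp (Real.pi * |k.im|) * ‖z‖ ^ k.re := by
  refine (norm_cpow_le z k).trans ?_
  rw [div_eq_mul_inv, ← Real.exp_neg, mul_comm]
  gcongr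
  calc -(arg z * k.im) ≤ |arg z * k.im| := neg_le_abs _
    _ = |arg z| * |k.im| := abs_mul _ _
    _ ≤ _ := by gcongr; exact abs_arg_le_pi z

/-- The branch point `-L` is never interior to the right half plane. It lies on the boundary only if
`Re L = 0`, and then `Re k > 0` gives continuity there. -/
theorem polyGrowth_add_cpow {L k : ℂ} (h0 : 0 ≤ L.re) (h : 0 < L.re ∨ 0 < k.re) :
    PolyGrowth fun s => (L + s) ^ k := by
  refine ⟨fun s hs => ContinuousAt.continuousWithinAt ?_, fun s hs => ?_, ?_⟩
  · by_cases hz : L + s ∈ slitPlane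
    · exact ContinuousAt.comp (f := fun s => L + s) (g := fun z => z ^ k)
        (continuousAt_cpow_const hz) (by fun_prop)
    · have hs : 0 ≤ s.re := hs
      rw [mem_slitPlane_iff, add_re, not_or, not_lt] at hz
      have hk : 0 < k.re := h.resolve_left (by linarith)
      exact ContinuousAt.comp (f := fun s => L + s) (g := fun z => z ^ k)
        (continuousAt_cpow_const_of_re_pos (Or.inl (by rw [add_re]; linarith)) hk) (by fun_prop)
  · have hs : 0 < s.re := hs
    refine DifferentiableAt.differentiableWithinAt ?_
    exact DifferentiableAt.cpow_const (by fun_prop)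
      (Or.inl (by rw [add_re]; linarith))
  · obtain ⟨C, M, hC, hb⟩ := exists_norm_add_rpow_le (L := L) (r := k.re)
      (h.symm.imp le_of_lt id)
    refine ⟨Real.exp (Real.pi * |k.im|) * C, M, by positivity, fun s hs => ?_⟩
    refine (norm_cpow_le_exp_mul _ _).trans ?_
    rw [mul_assoc]
    gcongr
    exact hb s hs

theorem polyGrowth_add_pow (L : ℂ) (k : ℕ) : PolyGrowth fun s => (L + s) ^ (k : ℂ) := by
  simp only [cpow_natCast]
  refine ⟨by fun_prop, by fun_prop, (1 + ‖L‖) ^ k, k, by positivity, fun s _ => ?_⟩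
  rw [norm_pow, ← mul_pow]
  gcongr
  exact norm_add_le_one_add_mul L s

/-! ### Fourier decay at an algebraic singularity. -/

/-- The bound on `f'` may blow up at 0, so the mean value inequality is applied on `[ε, t]` and `ε →
0`. -/
theorem norm_sub_le_rpow_of_norm_deriv_le {f f' : ℝ → ℂ} {σ C : ℝ} (hσ : 0 < σ) (hC : 0 ≤ C)
    (hc : Continuous f) (h1 : ∀ t, 0 < t → HasDerivAt f (f' t) t)
    (b1 : ∀ t, 0 < t → ‖f' t‖ ≤ C * t ^ (σ - 1)) {t : ℝ} (ht : 0 ≤ t) :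
    ‖f t - f 0‖ ≤ C / σ * t ^ σ := by
  rcases ht.eq_or_lt with rfl | ht
  · simp [Real.zero_rpow hσ.ne']
  have hlim : Tendsto (fun ε => ‖f t - f ε‖) (𝓝[>] 0) (𝓝 ‖f t - f 0‖) :=
    ((continuous_const.sub hc).norm.tendsto 0).mono_left nhdsWithin_le_nhds
  refine le_of_tendsto hlim ?_
  filter_upwards [Ioo_mem_nhdsGT ht] with ε hε
  refine image_norm_le_of_norm_deriv_right_le_deriv_boundary' (a := ε) (b := t)
    (f := fun x => f x - f ε) (f' := f') (B := fun x => C / σ * x ^ σ)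
    (B' := fun x => C * x ^ (σ - 1)) (by fun_prop) (fun x hx => ?_) ?_ ?_ (fun x hx => ?_)
    (fun x hx => b1 x (hε.1.trans_le hx.1)) ⟨hε.2.le, le_rfl⟩
  · exact ((h1 x (hε.1.trans_le hx.1)).sub_const _).hasDerivWithinAt
  · have := hε.1
    simp only [sub_self, norm_zero]
    positivity
  · exact ContinuousOn.mul continuousOn_const
      (continuousOn_id.rpow_const fun x _ => Or.inr hσ.le)
  · have hx0 : 0 < x := hε.1.trans_le hx.1
    refine (((Real.hasDerivAt_rpow_const (p := σ) (Or.inl hx0.ne')).const_mul (C / σ)).congr_deriv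
      ?_).hasDerivWithinAt
    field_simp

theorem norm_second_difference_le {f f' f'' : ℝ → ℂ} {t δ K : ℝ} (hδ : 0 ≤ δ)
    (h1 : ∀ x, |x - t| ≤ δ → HasDerivAt f (f' x) x)
    (h2 : ∀ x, |x - t| ≤ δ → HasDerivAt f' (f'' x) x)
    (b2 : ∀ x, |x - t| ≤ δ → ‖f'' x‖ ≤ K) :
    ‖f (t + δ) + f (t - δ) - 2 * f t‖ ≤ 2 * K * δ ^ 2 := by
  have hK : 0 ≤ K := (norm_nonneg _).trans (b2 t (by simpa using hδ))
  have hd : ∀ s ∈ Icc 0 δ, HasDerivWithinAt (fun s => f (t + s) + f (t - s))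
      (f' (t + s) - f' (t - s)) (Icc 0 δ) s := by
    intro s hs
    have e1 : HasDerivAt (fun s => f (t + s)) (f' (t + s)) s := by
      simpa using (h1 (t + s) (by simpa [abs_of_nonneg hs.1] using hs.2)).comp_const_add t s
    have e2 : HasDerivAt (fun s => f (t - s)) (-f' (t - s)) s := by
      simpa using (h1 (t - s) (by simpa [abs_of_nonneg hs.1] using hs.2)).comp_const_sub t s
    exact (HasDerivAt.congr_deriv (e1.add e2) (by ring)).hasDerivWithinAt
  have hb : ∀ s ∈ Icc 0 δ, ‖f' (t + s) - f' (t - s)‖ ≤ 2 * K * δ := by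
    intro s hs
    have := (convex_Icc (t - δ) (t + δ)).norm_image_sub_le_of_norm_hasDerivWithin_le
      (f := f') (f' := f'') (C := K) (x := t - s) (y := t + s)
      (fun x hx => (h2 x (abs_le.2 ⟨by linarith [hx.1], by linarith [hx.2]⟩)).hasDerivWithinAt)
      (fun x hx => b2 x (abs_le.2 ⟨by linarith [hx.1], by linarith [hx.2]⟩))
      ⟨by linarith [hs.2], by linarith [hs.1]⟩ ⟨by linarith [hs.1], by linarith [hs.2]⟩
    refine this.trans ?_
    rw [show t + s - (t - s) = 2 * s by ring, Real.norm_of_nonneg (by linarith [hs.1])]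
    nlinarith [hs.2]
  have := (convex_Icc 0 δ).norm_image_sub_le_of_norm_hasDerivWithin_le hd hb
    (left_mem_Icc.2 hδ) (right_mem_Icc.2 hδ)
  simp only [add_zero, sub_zero, Real.norm_of_nonneg hδ] at this
  calc _ = ‖f (t + δ) + f (t - δ) - (f t + f t)‖ := by rw [two_mul]
    _ ≤ _ := this
    _ = _ := by ring

/-- Decay of the Fourier transform of a function with an algebraic singularity of order `σ`. -/
theorem exists_norm_integral_mul_exp_le {f f' f'' : ℝ → ℂ} {σ C : ℝ} (hσ0 : 0 < σ) (hσ1 : σ < 1)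
    (hC : 0 ≤ C) (hf : Integrable f) (hc : Continuous f)
    (h1 : ∀ t, t ≠ 0 → HasDerivAt f (f' t) t) (h2 : ∀ t, t ≠ 0 → HasDerivAt f' (f'' t) t)
    (b1 : ∀ t, t ≠ 0 → ‖f' t‖ ≤ C * |t| ^ (σ - 1))
    (b2 : ∀ t, t ≠ 0 → ‖f'' t‖ ≤ C * |t| ^ (σ - 2)) :
    ∃ K : ℝ, ∀ x : ℝ, x ≠ 0 → ‖∫ t : ℝ, f t * cexp (t * I * x)‖ ≤ K * |x| ^ (-(1 + σ)) := by
  have hold : ∀ t : ℝ, ‖f t - f 0‖ ≤ C / σ * |t| ^ σ := by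
    intro t
    rcases le_total 0 t with ht | ht
    · rw [abs_of_nonneg ht]
      exact norm_sub_le_rpow_of_norm_deriv_le hσ0 hC hc (fun t ht => h1 t ht.ne')
        (fun t ht => by simpa [abs_of_pos ht] using b1 t ht.ne') ht
    · rw [abs_of_nonpos ht]
      have := norm_sub_le_rpow_of_norm_deriv_le (f := fun t => f (-t)) (f' := fun t => -f' (-t))
        hσ0 hC (hc.comp continuous_neg)
        (fun t ht => by
          simpa using HasDerivAt.comp_const_sub (f := f) (f' := f' (-t)) 0 t
            (by simpa using h1 (-t) (neg_ne_zero.2 ht.ne')))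
        (fun t ht => by simpa [abs_of_pos ht] using b1 (-t) (neg_ne_zero.2 ht.ne'))
        (t := -t) (by linarith)
      simpa using this
  set A : ℝ := 12 * (C / σ) * 3 ^ (2 - σ) with hA
  set B : ℝ := 2 * C * 2 ^ (2 - σ) * (3 / 2) ^ (2 - σ) with hB
  have hA0 : 0 ≤ A := by positivity
  have hB0 : 0 ≤ B := by positivity
  have hI : Integrable fun u : ℝ => (1 + ‖u‖) ^ (-(2 - σ)) :=
    integrable_one_add_norm (by simp; linarith)
  set J : ℝ := ∫ u : ℝ, (1 + ‖u‖) ^ (-(2 - σ)) with hJ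
  -- Two regimes share one integrable majorant. For `|t| ≤ 2δ` the Hölder bound gives `δ^σ`; for
  -- `|t| > 2δ` the interval of radius `δ` about `t` stays at distance at least `|t|/2` from 0, and
  -- the bound on `f''` gives `δ² |t|^(σ-2)`.
  have hD : ∀ δ : ℝ, 0 < δ → ∀ t : ℝ, ‖f (t + δ) + f (t - δ) - 2 * f t‖ ≤
      (A + B) * δ ^ σ * (1 + ‖δ⁻¹ * t‖) ^ (-(2 - σ)) := by
    intro δ hδ t
    have hu : ‖δ⁻¹ * t‖ = |t| / δ := by
      rw [norm_mul, Real.norm_of_nonneg (by positivity), Real.norm_eq_abs]; ring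
    rw [hu]
    rcases le_or_gt |t| (2 * δ) with ht | ht
    · have a1 : ∀ y : ℝ, |y| ≤ 3 * δ → ‖f y - f 0‖ ≤ C / σ * (3 * δ ^ σ) := by
        intro y hy
        refine (hold y).trans ?_
        gcongr
        calc |y| ^ σ ≤ (3 * δ) ^ σ := Real.rpow_le_rpow (abs_nonneg _) hy hσ0.le
          _ = 3 ^ σ * δ ^ σ := Real.mul_rpow (by norm_num) hδ.le
          _ ≤ 3 ^ (1 : ℝ) * δ ^ σ := by gcongr; norm_num
          _ = _ := by rw [Real.rpow_one]
      have c1 := a1 (t + δ) ((abs_add_le _ _).trans (by rw [abs_of_pos hδ]; linarith))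
      have c2 := a1 (t - δ) ((abs_sub _ _).trans (by rw [abs_of_pos hδ]; linarith))
      have c3 := a1 t (by linarith)
      have c4 : ‖f (t + δ) + f (t - δ) - 2 * f t‖ ≤ 12 * (C / σ) * δ ^ σ := by
        calc ‖f (t + δ) + f (t - δ) - 2 * f t‖
            = ‖(f (t + δ) - f 0) + (f (t - δ) - f 0) - (f t - f 0) - (f t - f 0)‖ := by
              congr 1; ring
          _ ≤ ‖f (t + δ) - f 0‖ + ‖f (t - δ) - f 0‖ + ‖f t - f 0‖ + ‖f t - f 0‖ := by
              refine (norm_sub_le _ _).trans ?_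
              gcongr
              refine (norm_sub_le _ _).trans ?_
              gcongr
              exact norm_add_le _ _
          _ ≤ _ := by linarith
      have c5 : 1 ≤ 3 ^ (2 - σ) * (1 + |t| / δ) ^ (-(2 - σ)) := by
        rw [Real.rpow_neg (by positivity), ← div_eq_mul_inv, one_le_div (by positivity)]
        refine Real.rpow_le_rpow (by positivity) ?_ (by linarith)
        have : |t| / δ ≤ 2 := by rw [div_le_iff₀ hδ]; exact ht
        linarith
      calc _ ≤ 12 * (C / σ) * δ ^ σ := c4
        _ ≤ 12 * (C / σ) * δ ^ σ * (3 ^ (2 - σ) * (1 + |t| / δ) ^ (-(2 - σ))) :=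
            le_mul_of_one_le_right (by positivity) c5
        _ = A * δ ^ σ * (1 + |t| / δ) ^ (-(2 - σ)) := by rw [hA]; ring
        _ ≤ _ := by gcongr; linarith
    · have ht0 : 0 < |t| := by linarith
      have hx : ∀ x : ℝ, |x - t| ≤ δ → |t| / 2 ≤ |x| := by
        intro x hx
        have := abs_sub_abs_le_abs_sub t x
        rw [abs_sub_comm] at this
        linarith
      have hx0 : ∀ x : ℝ, |x - t| ≤ δ → x ≠ 0 := fun x h => by
        rw [← abs_pos]; linarith [hx x h]
      have c1 := norm_second_difference_le (f := f) (f' := f') (f'' := f'') (t := t)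
        (K := C * (|t| / 2) ^ (σ - 2)) hδ.le
        (fun x h => h1 x (hx0 x h)) (fun x h => h2 x (hx0 x h)) (fun x h => by
          refine (b2 x (hx0 x h)).trans ?_
          exact mul_le_mul_of_nonneg_left
            (Real.rpow_le_rpow_of_nonpos (by linarith) (hx x h) (by linarith)) hC)
      have c2 : (|t| / 2) ^ (σ - 2) * δ ^ 2 = 2 ^ (2 - σ) * δ ^ σ * (|t| / δ) ^ (-(2 - σ)) := by
        rw [show σ - 2 = -(2 - σ) by ring, Real.div_rpow ht0.le zero_le_two,
          Real.div_rpow ht0.le hδ.le, Real.rpow_neg zero_le_two, Real.rpow_neg hδ.le,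
          Real.rpow_sub hδ, Real.rpow_two]
        have : δ ^ σ ≠ 0 := by positivity
        field_simp
      have c3 : (|t| / δ) ^ (-(2 - σ)) ≤ (3 / 2) ^ (2 - σ) * (1 + |t| / δ) ^ (-(2 - σ)) := by
        have h2t : 2 ≤ |t| / δ := by rw [le_div_iff₀ hδ]; exact ht.le
        rw [Real.rpow_neg (by positivity), Real.rpow_neg (by positivity), ← div_eq_mul_inv,
          ← Real.div_rpow (by norm_num) (by positivity), ← Real.inv_rpow (by positivity)]
        refine Real.rpow_le_rpow (by positivity) ?_ (by linarith)
        rw [inv_eq_one_div, div_le_div_iff₀ (by linarith) (by linarith)]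
        linarith
      calc _ ≤ 2 * (C * (|t| / 2) ^ (σ - 2)) * δ ^ 2 := c1
        _ = 2 * C * (2 ^ (2 - σ) * δ ^ σ * (|t| / δ) ^ (-(2 - σ))) := by rw [← c2]; ring
        _ ≤ 2 * C * (2 ^ (2 - σ) * δ ^ σ * ((3 / 2) ^ (2 - σ) * (1 + |t| / δ) ^ (-(2 - σ)))) := by
            gcongr
        _ = B * δ ^ σ * (1 + |t| / δ) ^ (-(2 - σ)) := by rw [hB]; ring
        _ ≤ _ := by gcongr; linarith
  have hexp : ∀ x t : ℝ, ‖cexp (t * I * x)‖ = 1 := by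
    intro x t
    rw [show (t * I * x : ℂ) = ((t * x : ℝ) : ℂ) * I by push_cast; ring, norm_exp_ofReal_mul_I]
  have hint : ∀ x d : ℝ, Integrable fun t : ℝ => f (t + d) * cexp (t * I * x) := by
    intro x d
    refine (hf.comp_add_right d).mul_bdd (c := 1) (by fun_prop) ?_
    exact Eventually.of_forall fun t => (hexp x t).le
  have htrans : ∀ x d : ℝ, ∫ t : ℝ, f (t + d) * cexp (t * I * x) =
      cexp (-(d * x * I)) * ∫ t : ℝ, f t * cexp (t * I * x) := by
    intro x d
    rw [← integral_const_mul, 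
      ← integral_add_right_eq_self (fun t : ℝ => cexp (-(d * x * I)) * (f t * cexp (t * I * x))) d]
    congr 1 with t
    rw [mul_left_comm, ← Complex.exp_add]
    congr 2
    push_cast; ring
  refine ⟨(A + B) * Real.pi ^ (1 + σ) * J / 4, fun x hx => ?_⟩
  -- With this `δ`, translating by `±δ` multiplies the Fourier integral by `-1`, so the second
  -- difference of `f` has transform `-4` times that of `f`. Its `L¹` norm is of order `δ^(1+σ)`.
  set δ : ℝ := Real.pi / |x| with hδ
  have hx0 : 0 < |x| := abs_pos.2 hx
  have hδ0 : 0 < δ := by positivity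
  have hcexp : ∀ ε : ℝ, |ε| = 1 → cexp (-((ε * δ : ℝ) * x * I)) = -1 := by
    intro ε hε
    have h3 : ε * δ * x = Real.pi ∨ ε * δ * x = -Real.pi := by
      rw [← abs_eq Real.pi_pos.le, abs_mul, abs_mul, hε, abs_of_pos hδ0, hδ]
      field_simp
    rw [← ofReal_mul]
    rcases h3 with h3 | h3 <;> rw [h3]
    · rw [Complex.exp_neg, Complex.exp_pi_mul_I]; norm_num
    · rw [ofReal_neg, neg_mul, neg_neg, Complex.exp_pi_mul_I]
  have hkey : ∫ t : ℝ, (f (t + δ) + f (t - δ) - 2 * f t) * cexp (t * I * x) =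
      -4 * ∫ t : ℝ, f t * cexp (t * I * x) := by
    have k1 := htrans x δ
    have k2 := htrans x (-δ)
    have k3 := hcexp 1 (by simp)
    have k4 := hcexp (-1) (by simp)
    rw [one_mul] at k3
    rw [neg_one_mul] at k4
    rw [k3] at k1
    rw [k4] at k2
    have k5 : ∀ t : ℝ, (f (t + δ) + f (t - δ) - 2 * f t) * cexp (t * I * x) =
        f (t + δ) * cexp (t * I * x) + f (t + -δ) * cexp (t * I * x) -
          2 * (f t * cexp (t * I * x)) := by
      intro t; rw [← sub_eq_add_neg]; ring
    simp_rw [k5]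
    have i0 : Integrable fun t : ℝ => f t * cexp (t * I * x) := by simpa using hint x 0
    have i1 : Integrable fun t : ℝ => f (t + δ) * cexp (t * I * x) + f (t + -δ) * cexp (t * I * x) :=
      (hint x δ).add (hint x (-δ))
    rw [integral_sub i1 (i0.const_mul 2),
      integral_add (hint x δ) (hint x (-δ)), integral_const_mul, k1, k2]
    ring
  have hb : ‖∫ t : ℝ, (f (t + δ) + f (t - δ) - 2 * f t) * cexp (t * I * x)‖ ≤
      (A + B) * δ ^ σ * (δ * J) := by
    have e1 : δ * J = ∫ t : ℝ, (1 + ‖δ⁻¹ * t‖) ^ (-(2 - σ)) := by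
      rw [Measure.integral_comp_mul_left (fun u : ℝ => (1 + ‖u‖) ^ (-(2 - σ))) δ⁻¹, inv_inv,
        abs_of_pos hδ0, smul_eq_mul]
    rw [e1, ← integral_const_mul]
    refine norm_integral_le_of_norm_le ?_ (Eventually.of_forall fun t => ?_)
    · exact (hI.comp_mul_left' (inv_ne_zero hδ0.ne')).const_mul _
    · rw [norm_mul, hexp, mul_one]
      exact hD δ hδ0 t
  rw [hkey, norm_mul, norm_neg, Complex.norm_ofNat] at hb
  have e2 : δ ^ σ * δ = Real.pi ^ (1 + σ) * |x| ^ (-(1 + σ)) := by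
    rw [Real.rpow_neg hx0.le, ← div_eq_mul_inv, ← Real.div_rpow Real.pi_pos.le hx0.le, ← hδ,
      Real.rpow_add hδ0, Real.rpow_one, mul_comm]
  have e3 : (A + B) * δ ^ σ * (δ * J) = (A + B) * (δ ^ σ * δ) * J := by ring
  rw [e3, e2] at hb
  linarith

/-- Split off `‖L + it‖^(σ-i) ≤ |t + Im L|^(σ-i)`. The remaining exponent `Re k - j - (σ - i)` is
nonnegative unless `Re L > 0`, so that factor grows polynomially and sech absorbs it. -/
theorem exists_norm_add_cpow_mul_le {L k w : ℂ} (hw : |w.im| < Real.pi / 2) {σ : ℝ}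
    (hσ : σ < 1) (h : σ ≤ k.re ∨ 0 < L.re) {i j : ℕ} (hj : j ≤ i) (hi : 1 ≤ i) :
    ∃ C : ℝ, 0 ≤ C ∧ ∀ t : ℝ, t + L.im ≠ 0 →
      ‖(L + t * I) ^ (k - j) * (cexp (t * I * w) / Complex.cosh (Real.pi * t / 2))‖ ≤
        C * |t + L.im| ^ (σ - i) := by
  obtain ⟨C, M, hC, hb⟩ := exists_norm_add_rpow_le (L := L) (r := k.re - j - (σ - i)) (by
    refine h.imp_left fun h => ?_
    have : (j : ℝ) ≤ i := by exact_mod_cast hj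
    linarith)
  obtain ⟨K, hK, hKb⟩ := one_add_pow_le_exp (sub_pos.2 hw) M
  refine ⟨Real.exp (Real.pi * |k.im|) * C * K * 2, by positivity, fun t ht => ?_⟩
  set z : ℂ := L + t * I with hz
  have hzre : z.re = L.re := by simp [hz]
  have hzim : z.im = t + L.im := by simp [hz, add_comm]
  have hut : |t + L.im| ≤ ‖z‖ := by rw [← hzim]; exact abs_im_le_norm z
  have hu : 0 < |t + L.im| := abs_pos.2 ht
  have hz0 : 0 < ‖z‖ := hu.trans_le hut
  have h1 : ‖z ^ (k - j)‖ ≤ Real.exp (Real.pi * |k.im|) *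
      (C * (1 + |t|) ^ M * |t + L.im| ^ (σ - i)) := by
    refine (norm_cpow_le_exp_mul _ _).trans ?_
    rw [sub_im, natCast_im, sub_zero, sub_re, natCast_re,
      show k.re - j = (k.re - j - (σ - i)) + (σ - i) by ring, Real.rpow_add hz0]
    have h2 := hb (t * I) (by simp)
    rw [norm_ofReal_mul_I] at h2
    have h3 : ‖z‖ ^ (σ - i) ≤ |t + L.im| ^ (σ - i) := by
      refine Real.rpow_le_rpow_of_nonpos hu hut ?_
      have : (1 : ℝ) ≤ i := by exact_mod_cast hi
      linarith
    gcongr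
  have h4 := norm_exp_div_cosh_le t w
  have h5 := hKb |t| (abs_nonneg t)
  rw [norm_mul]
  calc _ ≤ (Real.exp (Real.pi * |k.im|) *
        (C * (K * Real.exp ((Real.pi / 2 - |w.im|) * |t|)) * |t + L.im| ^ (σ - i))) *
        (2 * Real.exp (-(Real.pi / 2 - |w.im|) * |t|)) := by
        gcongr
        refine h1.trans ?_
        gcongr
    _ = Real.exp (Real.pi * |k.im|) * C * K * 2 * |t + L.im| ^ (σ - i) *
        (Real.exp ((Real.pi / 2 - |w.im|) * |t|) *
          Real.exp (-(Real.pi / 2 - |w.im|) * |t|)) := by ring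
    _ = _ := by rw [← Real.exp_add, neg_mul, add_neg_cancel, Real.exp_zero, mul_one]

/-- The logarithmic derivative of `t ↦ exp (itw) / cosh (πt/2)`. -/
noncomputable def sechLogDeriv (w : ℂ) (t : ℝ) : ℂ :=
  I * w - Real.pi / 2 * (Complex.sinh (Real.pi * t / 2) / Complex.cosh (Real.pi * t / 2))

theorem hasDerivAt_exp_div_cosh (w : ℂ) (t : ℝ) :
    HasDerivAt (fun t : ℝ => cexp (t * I * w) / Complex.cosh (Real.pi * t / 2))
      (cexp (t * I * w) / Complex.cosh (Real.pi * t / 2) * sechLogDeriv w t) t := by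
  have h0 := cosh_pi_mul_div_two_ne_zero t
  have h1 : HasDerivAt (fun z : ℂ => z * I * w) (I * w) (t : ℂ) := by
    simpa using ((hasDerivAt_id (t : ℂ)).mul_const I).mul_const w
  have h2 : HasDerivAt (fun z : ℂ => Real.pi * z / 2) (Real.pi / 2) (t : ℂ) := by
    simpa using ((hasDerivAt_id (t : ℂ)).const_mul (Real.pi : ℂ)).div_const 2
  refine ((h1.cexp.div h2.ccosh h0).comp_ofReal).congr_deriv ?_
  rw [sechLogDeriv]
  generalize Complex.cosh (Real.pi * t / 2) = c at h0 ⊢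
  field_simp

theorem hasDerivAt_sechLogDeriv (w : ℂ) (t : ℝ) :
    HasDerivAt (sechLogDeriv w)
      (-((Real.pi / 2) ^ 2 * (1 / Complex.cosh (Real.pi * t / 2) ^ 2))) t := by
  have h0 := cosh_pi_mul_div_two_ne_zero t
  have h2 : HasDerivAt (fun z : ℂ => Real.pi * z / 2) (Real.pi / 2) (t : ℂ) := by
    simpa using ((hasDerivAt_id (t : ℂ)).const_mul (Real.pi : ℂ)).div_const 2
  have h3 := ((((h2.csinh.div h2.ccosh h0).const_mul (Real.pi / 2 : ℂ)).const_sub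
    (I * w)).comp_ofReal)
  refine h3.congr_deriv ?_
  have h4 := Complex.cosh_sq_sub_sinh_sq (Real.pi * t / 2)
  field_simp
  linear_combination -h4

theorem norm_sechLogDeriv_le (w : ℂ) (t : ℝ) : ‖sechLogDeriv w t‖ ≤ ‖w‖ + Real.pi / 2 := by
  refine (norm_sub_le _ _).trans ?_
  have h1 : ‖Complex.sinh (Real.pi * t / 2) / Complex.cosh (Real.pi * t / 2)‖ ≤ 1 := by
    rw [show (Real.pi * t / 2 : ℂ) = ((Real.pi * t / 2 : ℝ) : ℂ) by push_cast; rfl,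
      ← ofReal_sinh, ← ofReal_cosh, norm_div, norm_real, norm_real,
      Real.norm_of_nonneg (Real.cosh_pos _).le, div_le_one (Real.cosh_pos _), Real.norm_eq_abs,
      abs_le]
    constructor
    · rw [← sub_nonneg, sub_neg_eq_add, add_comm, Real.cosh_add_sinh]; positivity
    · exact (Real.sinh_lt_cosh _).le
  have h2 : ‖(Real.pi / 2 : ℂ)‖ = Real.pi / 2 := by
    rw [show (Real.pi / 2 : ℂ) = ((Real.pi / 2 : ℝ) : ℂ) by push_cast; rfl, norm_real,
      Real.norm_of_nonneg (by positivity)]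
  rw [norm_mul, norm_mul, h2, norm_I, one_mul]
  have := mul_le_mul_of_nonneg_left h1 (by positivity : 0 ≤ Real.pi / 2)
  linarith

theorem norm_deriv_sechLogDeriv_le (t : ℝ) :
    ‖-((Real.pi / 2 : ℂ) ^ 2 * (1 / Complex.cosh (Real.pi * t / 2) ^ 2))‖ ≤ (Real.pi / 2) ^ 2 := by
  have h2 : ‖(Real.pi / 2 : ℂ)‖ = Real.pi / 2 := by
    rw [show (Real.pi / 2 : ℂ) = ((Real.pi / 2 : ℝ) : ℂ) by push_cast; rfl, norm_real,
      Real.norm_of_nonneg (by positivity)]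
  rw [norm_neg, norm_mul, norm_pow, h2, norm_div, norm_one, norm_pow, cosh_pi_mul_div_two,
    norm_real, Real.norm_of_nonneg (Real.cosh_pos _).le]
  refine mul_le_of_le_one_right (by positivity) ?_
  rw [div_le_one (by have := Real.cosh_pos (Real.pi * t / 2); positivity)]
  exact one_le_pow₀ (Real.one_le_cosh _)

theorem hasDerivAt_add_mul_I_cpow {L k : ℂ} {t : ℝ} (ht : t + L.im ≠ 0) :
    HasDerivAt (fun t : ℝ => (L + t * I) ^ k) (k * I * (L + t * I) ^ (k - 1)) t := by
  have h1 : HasDerivAt (fun z : ℂ => L + z * I) I (t : ℂ) := by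
    simpa using ((hasDerivAt_id (t : ℂ)).mul_const I).const_add L
  refine ((h1.cpow_const (c := k) (Or.inr ?_)).comp_ofReal).congr_deriv (by ring)
  simpa [add_comm] using ht

/-- `sechTransform` of a power decays along horizontal lines. -/
theorem exists_norm_sechTransform_cpow_le {L k w : ℂ} (hL : 0 ≤ L.re) (h : 0 < L.re ∨ 0 < k.re)
    (hw : |w.im| < Real.pi / 2) :
    ∃ σ : ℝ, 0 < σ ∧ ∃ K : ℝ, ∀ x : ℝ, x ≠ 0 →
      ‖sechTransform (fun s => (L + s) ^ k) (w + x)‖ ≤ K * |x| ^ (-(1 + σ)) := by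
  -- If `Re L > 0` any `σ` in `(0, 1)` serves; otherwise `σ` may not exceed `Re k`, the order of the
  -- singularity.
  obtain ⟨σ, hσ0, hσ1, hσ⟩ : ∃ σ : ℝ, 0 < σ ∧ σ < 1 ∧ (σ ≤ k.re ∨ 0 < L.re) := by
    rcases h with h | h
    · exact ⟨1 / 2, by norm_num, by norm_num, Or.inr h⟩
    · exact ⟨min (1 / 2) k.re, by positivity, (min_le_left _ _).trans_lt (by norm_num),
        Or.inl (min_le_right _ _)⟩
  refine ⟨σ, hσ0, ?_⟩
  have hP := polyGrowth_add_cpow hL h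
  set E : ℝ → ℂ := fun t => cexp (t * I * w) / Complex.cosh (Real.pi * t / 2) with hE
  set q := sechLogDeriv w with hq
  set q' : ℝ → ℂ := fun t => -((Real.pi / 2) ^ 2 * (1 / Complex.cosh (Real.pi * t / 2) ^ 2))
    with hq'
  set A : ℝ := ‖w‖ + Real.pi / 2 with hA
  have hA0 : 0 ≤ A := by positivity
  obtain ⟨C01, p01, b01⟩ := exists_norm_add_cpow_mul_le hw hσ1 hσ (Nat.zero_le 1) le_rfl
  obtain ⟨C11, p11, b11⟩ := exists_norm_add_cpow_mul_le hw hσ1 hσ (le_refl 1) le_rfl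
  obtain ⟨C02, p02, b02⟩ := exists_norm_add_cpow_mul_le hw hσ1 hσ (Nat.zero_le 2) one_le_two
  obtain ⟨C12, p12, b12⟩ := exists_norm_add_cpow_mul_le hw hσ1 hσ one_le_two one_le_two
  obtain ⟨C22, p22, b22⟩ := exists_norm_add_cpow_mul_le hw hσ1 hσ (le_refl 2) one_le_two
  simp only [Nat.cast_zero, sub_zero, Nat.cast_one, Nat.cast_ofNat] at b01 b11 b02 b12 b22
  have hEd : ∀ t, HasDerivAt E (E t * q t) t := hasDerivAt_exp_div_cosh w
  have hqd : ∀ t, HasDerivAt q (q' t) t := hasDerivAt_sechLogDeriv w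
  have hqb : ∀ t, ‖q t‖ ≤ A := norm_sechLogDeriv_le w
  have hqb' : ∀ t, ‖q' t‖ ≤ (Real.pi / 2) ^ 2 := norm_deriv_sechLogDeriv_le
  set f : ℝ → ℂ := fun t => (L + t * I) ^ k * E t with hf
  set f' : ℝ → ℂ := fun t => k * I * ((L + t * I) ^ (k - 1) * E t) +
    (L + t * I) ^ k * E t * q t with hf'
  set f'' : ℝ → ℂ := fun t => k * I * ((k - 1) * I * ((L + t * I) ^ (k - 2) * E t) +
    (L + t * I) ^ (k - 1) * E t * q t) + (f' t * q t + (L + t * I) ^ k * E t * q' t) with hf''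
  have d1 : ∀ t : ℝ, t + L.im ≠ 0 → HasDerivAt f (f' t) t := by
    intro t ht
    refine ((hasDerivAt_add_mul_I_cpow ht).mul (hEd t)).congr_deriv ?_
    simp only [hf']; ring
  have d2 : ∀ t : ℝ, t + L.im ≠ 0 → HasDerivAt f' (f'' t) t := by
    intro t ht
    refine ((((hasDerivAt_add_mul_I_cpow (k := k - 1) ht).mul (hEd t)).const_mul
      (k * I)).add ((d1 t ht).mul (hqd t))).congr_deriv ?_
    simp only [hf'', hf, show k - 1 - 1 = k - 2 by ring]; ring
  set C1 : ℝ := ‖k‖ * C11 + C01 * A with hC1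
  set C2 : ℝ := ‖k‖ * (‖k - 1‖ * C22 + C12 * A) + ((‖k‖ * C12 + C02 * A) * A +
    C02 * (Real.pi / 2) ^ 2) with hC2
  have e1 : ∀ t : ℝ, t + L.im ≠ 0 → ‖f' t‖ ≤ C1 * |t + L.im| ^ (σ - 1) := by
    intro t ht
    refine (norm_add_le _ _).trans ?_
    rw [norm_mul, norm_mul, norm_I, mul_one, norm_mul _ (q t)]
    calc _ ≤ ‖k‖ * (C11 * |t + L.im| ^ (σ - 1)) + C01 * |t + L.im| ^ (σ - 1) * A := by
          gcongr
          · exact b11 t ht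
          · exact b01 t ht
          · exact hqb t
      _ = _ := by rw [hC1]; ring
  have e2 : ∀ t : ℝ, t + L.im ≠ 0 → ‖f'' t‖ ≤ C2 * |t + L.im| ^ (σ - 2) := by
    intro t ht
    set X := |t + L.im| ^ (σ - 2) with hX
    have hX0 : 0 ≤ X := by positivity
    have g2 : ‖(k - 1) * I * ((L + t * I) ^ (k - 2) * E t)‖ ≤ ‖k - 1‖ * (C22 * X) := by
      rw [norm_mul, norm_mul, norm_I, mul_one]
      gcongr
      exact b22 t ht
    have g1 : ‖(L + t * I) ^ (k - 1) * E t * q t‖ ≤ C12 * X * A := by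
      rw [norm_mul]
      gcongr
      · exact b12 t ht
      · exact hqb t
    have g0 : ‖(L + t * I) ^ k * E t * q t‖ ≤ C02 * X * A := by
      rw [norm_mul]
      gcongr
      · exact b02 t ht
      · exact hqb t
    have g0' : ‖(L + t * I) ^ k * E t * q' t‖ ≤ C02 * X * (Real.pi / 2) ^ 2 := by
      rw [norm_mul]
      gcongr
      · exact b02 t ht
      · exact hqb' t
    have g3 : ‖f' t‖ ≤ ‖k‖ * (C12 * X) + C02 * X * A := by
      refine (norm_add_le _ _).trans (add_le_add ?_ g0)
      rw [norm_mul, norm_mul, norm_I, mul_one]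
      gcongr
      exact b12 t ht
    have g4 : ‖f' t * q t‖ ≤ (‖k‖ * (C12 * X) + C02 * X * A) * A := by
      rw [norm_mul]
      gcongr
      exact hqb t
    have g5 : ‖k * I * ((k - 1) * I * ((L + t * I) ^ (k - 2) * E t) +
        (L + t * I) ^ (k - 1) * E t * q t)‖ ≤ ‖k‖ * (‖k - 1‖ * (C22 * X) + C12 * X * A) := by
      rw [norm_mul, norm_mul, norm_I, mul_one]
      gcongr
      exact (norm_add_le _ _).trans (add_le_add g2 g1)
    calc ‖f'' t‖ ≤ ‖k‖ * (‖k - 1‖ * (C22 * X) + C12 * X * A) +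
          ((‖k‖ * (C12 * X) + C02 * X * A) * A + C02 * X * (Real.pi / 2) ^ 2) :=
          (norm_add_le _ _).trans (add_le_add g5 ((norm_add_le _ _).trans (add_le_add g4 g0')))
      _ = _ := by rw [hC2]; ring
  have hC10 : 0 ≤ C1 := by positivity
  have hC20 : 0 ≤ C2 := by positivity
  -- Translation by `Im L` moves the possible singularity to 0; on the Fourier side it only
  -- contributes a factor of modulus 1.
  have hne : ∀ u : ℝ, u ≠ 0 → u - L.im + L.im ≠ 0 := fun u hu => by simpa using hu
  obtain ⟨K, hK⟩ := exists_norm_integral_mul_exp_le (f := fun u => f (u - L.im))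
    (f' := fun u => f' (u - L.im)) (f'' := fun u => f'' (u - L.im)) (C := C1 + C2) hσ0 hσ1
    (by positivity) ((hP.integrable hw).comp_sub_right _)
    ((hP.continuous_mul_I.mul (continuous_exp_div_cosh w)).comp (by fun_prop))
    (fun u hu => (d1 _ (hne u hu)).comp_sub_const u L.im)
    (fun u hu => (d2 _ (hne u hu)).comp_sub_const u L.im)
    (fun u hu => (e1 _ (hne u hu)).trans (by rw [sub_add_cancel]; gcongr; linarith))
    (fun u hu => (e2 _ (hne u hu)).trans (by rw [sub_add_cancel]; gcongr; linarith))
  refine ⟨K, fun x hx => ?_⟩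
  refine le_trans (le_of_eq ?_) (hK x hx)
  have hshift : ∫ u : ℝ, f (u - L.im) * cexp (u * I * x) =
      cexp (L.im * I * x) * sechTransform (fun s => (L + s) ^ k) (w + x) := by
    rw [← integral_add_right_eq_self (fun u : ℝ => f (u - L.im) * cexp (u * I * x)) L.im,
      sechTransform, ← integral_const_mul]
    congr 1 with t
    simp only [hf, hE, add_sub_cancel_right]
    rw [mul_add (t * I : ℂ), Complex.exp_add, ofReal_add, add_mul, add_mul, Complex.exp_add]
    ring
  rw [hshift, norm_mul, show (L.im * I * x : ℂ) = ((L.im * x : ℝ) : ℂ) * I by push_cast; ring,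
    norm_exp_ofReal_mul_I, one_mul]

/-! ### Poisson summation. -/

/-- The terms of the dual series: the integrand of `sechTransform` at the complex point `x`. -/
noncomputable def sechTerm (P : ℂ → ℂ) (w x : ℂ) : ℂ :=
  P (x * I) * (cexp (x * I * w) / Complex.cosh (Real.pi * x / 2))

open FourierTransform in
theorem PolyGrowth.poisson {P : ℂ → ℂ} (hP : PolyGrowth P) {w : ℂ} (hw : |w.im| < Real.pi / 2)
    {a : ℝ} (ha : 0 < a) (hs : Summable fun n : ℤ => sechTransform P (w + n * a)) :
    (Summable fun n : ℤ => sechTerm P w (2 * Real.pi * n / a)) ∧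
    ∑' n : ℤ, sechTransform P (w + n * a) =
      2 * Real.pi / a * ∑' n : ℤ, sechTerm P w (2 * Real.pi * n / a) := by
  have hpi := Real.pi_pos
  set f : ℝ → ℂ := fun t => sechTerm P w t with hf
  have hfc : Continuous f := hP.continuous_mul_I.mul (continuous_exp_div_cosh w)
  set b : ℝ := 2 * Real.pi / a with hb
  have hb0 : 0 < b := by positivity
  -- Rescaling by `b = 2π/a` makes the Fourier coefficient at `n` equal to `a/(2π)` times the
  -- transform at `w - na`; the sign is undone by reindexing.
  set h : ℝ → ℂ := fun u => f (b * u) with hh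
  have hhc : Continuous h := hfc.comp (by fun_prop)
  have hO : h =O[cocompact ℝ] fun x : ℝ => |x| ^ (-2 : ℝ) := by
    obtain ⟨C, M, hC, hbd⟩ := hP.bound
    obtain ⟨K, hK, hKb⟩ := one_add_pow_le_exp (sub_pos.2 hw) (M + 2)
    refine Asymptotics.IsBigO.of_bound (2 * C * K / b ^ 2) ?_
    filter_upwards [(isCompact_singleton (x := (0 : ℝ))).compl_mem_cocompact] with u hu
    have hu : u ≠ 0 := hu
    have h1 := norm_sechTransform_integrand_le hC hbd w (b * u)
    have hu0 : 0 < |u| := abs_pos.2 hu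
    have hbu0 : 0 < |b * u| := abs_pos.2 (mul_ne_zero hb0.ne' hu)
    have h2 := hKb |b * u| (abs_nonneg _)
    rw [Real.norm_of_nonneg (by positivity), Real.rpow_neg hu0.le, Real.rpow_two]
    refine h1.trans ?_
    have h3 : (1 + |b * u|) ^ M * Real.exp (-(Real.pi / 2 - |w.im|) * |b * u|) ≤
        K * (|b * u| ^ 2)⁻¹ := by
      rw [neg_mul, Real.exp_neg, ← div_eq_mul_inv, ← div_eq_mul_inv,
        div_le_div_iff₀ (Real.exp_pos _) (by positivity)]
      refine le_trans ?_ h2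
      rw [pow_add]
      gcongr
      linarith
    calc _ ≤ 2 * C * (K * (|b * u| ^ 2)⁻¹) := by gcongr
      _ = _ := by
        rw [abs_mul, abs_of_pos hb0]
        field_simp
  have hF : ∀ n : ℤ, 𝓕 h n = (a / (2 * Real.pi) : ℝ) * sechTransform P (w + (-n : ℤ) * a) := by
    intro n
    rw [Real.fourier_real_eq_integral_exp_smul, sechTransform]
    have h1 := Measure.integral_comp_mul_left
      (fun t : ℝ => P (t * I) * (cexp (t * I * (w + (-n : ℤ) * a)) /
        Complex.cosh (Real.pi * t / 2))) b
    rw [abs_of_pos (by positivity), real_smul, hb, inv_div] at h1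
    rw [← h1]
    congr 1 with u
    simp only [hh, hf, sechTerm, smul_eq_mul]
    rw [mul_add, Complex.exp_add]
    have e : ((-2 * Real.pi * u * (n : ℝ) : ℝ) : ℂ) * I =
        ((2 * Real.pi / a * u : ℝ) : ℂ) * I * ((-n : ℤ) * a) := by
      have : (a : ℂ) ≠ 0 := by exact_mod_cast ha.ne'
      push_cast
      field_simp
    rw [e]
    ring
  have hsF : Summable fun n : ℤ => 𝓕 h n := by
    simp_rw [hF]
    exact ((Equiv.neg ℤ).summable_iff.2 hs).mul_left _
  have hpoi := Real.tsum_eq_tsum_fourier_of_rpow_decay_of_summable hhc one_lt_two hO hsF 0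
  have hT : ∀ n : ℤ, h n = sechTerm P w (2 * Real.pi * n / a) := by
    intro n
    simp only [hh, hf, hb]
    congr 1
    push_cast; ring
  constructor
  · have := summable_of_isBigO (Real.summable_abs_int_rpow one_lt_two)
      (hO.comp_tendsto Int.tendsto_coe_cofinite)
    exact this.congr fun n => (hT n)
  · simp only [zero_add, QuotientAddGroup.mk_zero, fourier_eval_zero, mul_one, hT, hF] at hpoi
    have hneg := (Equiv.neg ℤ).tsum_eq fun n : ℤ => sechTransform P (w + n * a)
    simp only [Equiv.neg_apply] at hneg
    rw [hpoi, tsum_mul_left, hneg, ← mul_assoc]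
    have h1 : (a : ℂ) ≠ 0 := by exact_mod_cast ha.ne'
    have h2 : (Real.pi : ℂ) ≠ 0 := by exact_mod_cast hpi.ne'
    have : 2 * Real.pi / a * ((a / (2 * Real.pi) : ℝ) : ℂ) = 1 := by
      push_cast; field_simp
    rw [this, one_mul]

/-! ### Locally uniform convergence in complex `α`. -/

theorem summable_int_one_add_abs_pow_mul_exp {c : ℝ} (hc : 0 < c) (M : ℕ) :
    Summable fun n : ℤ => (1 + |(n : ℝ)|) ^ M * Real.exp (-c * |(n : ℝ)|) := by
  have h := summable_pow_mul_geometric 1 1 (Real.exp_pos (-c)).le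
    (Real.exp_lt_one_iff.2 (neg_lt_zero.2 hc)) M
  have h' : Summable fun n : ℕ => (1 + (n : ℝ)) ^ M * Real.exp (-c * n) := by
    refine h.congr fun n => ?_
    rw [← Real.exp_nat_mul]
    ring_nf
  refine Summable.of_nat_of_neg ?_ ?_ <;> simpa using h'

theorem eventually_cofinite_le_abs (r : ℝ) : ∀ᶠ n : ℤ in cofinite, r ≤ |(n : ℝ)| :=
  (tendsto_norm_cocompact_atTop.comp Int.tendsto_coe_cofinite).eventually_ge_atTop r

theorem cosh_ne_zero_of_re_ne_zero {w : ℂ} (hw : w.re ≠ 0) : Complex.cosh w ≠ 0 := by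
  rw [← norm_pos_iff]
  exact (Real.sinh_pos_iff.2 (abs_pos.2 hw)).trans_le (sinh_abs_re_le_norm_cosh w)

theorem exists_le_re_norm_le_of_isCompact {K : Set ℂ} (hK : K ⊆ {z | 0 < z.re})
    (hKc : IsCompact K) : ∃ δ R : ℝ, 0 < δ ∧ 0 < R ∧ ∀ z ∈ K, δ ≤ z.re ∧ ‖z‖ ≤ R := by
  rcases K.eq_empty_or_nonempty with rfl | hne
  · exact ⟨1, 1, one_pos, one_pos, by simp⟩
  · obtain ⟨z₀, hz₀, hmin⟩ := hKc.exists_isMinOn hne continuous_re.continuousOn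
    obtain ⟨R, hR0, hR⟩ := hKc.isBounded.exists_pos_norm_le
    exact ⟨z₀.re, R, hK hz₀, hR0, fun z hz => ⟨hmin hz, hR z hz⟩⟩

theorem inv_re_pos {z : ℂ} (hz : 0 < z.re) : 0 < (z⁻¹).re := by
  rw [inv_re]
  have : z ≠ 0 := by rintro rfl; simp at hz
  have := normSq_pos.2 this
  positivity

theorem re_ofReal_div (r : ℝ) (z : ℂ) : ((r : ℂ) / z).re = r * (z⁻¹).re := by
  rw [div_eq_mul_inv, re_ofReal_mul]

/-- The terms of the left-hand series for integral `k`, along the line `iy + xα`. -/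
noncomputable def lerchTerm (v : ℂ) (k : ℕ) (w : ℂ) : ℂ := cexp w * lerchRat v k (-cexp (2 * w))

/-- This keeps every argument `-e^(2w)` away from the pole 1. The real part is `x Re α`, so `|y| <
π/2` is needed only for `x = 0`. -/
theorem cosh_line_ne_zero {y x : ℝ} (hy : |y| < Real.pi / 2) {α : ℂ} (hα : 0 < α.re) :
    Complex.cosh (I * y + x * α) ≠ 0 := by
  by_cases hx : x = 0
  · apply cosh_ne_zero_of_abs_im_lt
    simpa [hx] using hy
  · apply cosh_ne_zero_of_re_ne_zero
    simp [hx, hα.ne']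

theorem differentiableAt_lerchTerm (v : ℂ) (k : ℕ) {w : ℂ} (hw : Complex.cosh w ≠ 0) :
    DifferentiableAt ℂ (lerchTerm v k) w := by
  refine DifferentiableAt.mul (by fun_prop) ?_
  exact DifferentiableAt.comp (f := fun w => -cexp (2 * w)) (g := lerchRat v k) w
    (hasDerivAt_lerchRat v k (neg_exp_two_mul_ne_one hw)).differentiableAt (by fun_prop)

theorem summableLocallyUniformlyOn_lerchTerm (v : ℂ) (k : ℕ) (y c : ℝ) :
    SummableLocallyUniformlyOn
      (fun (n : ℤ) (α : ℂ) => lerchTerm v k (I * y + ((c + n : ℝ) : ℂ) * α)) {α | 0 < α.re} := by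
  refine SummableLocallyUniformlyOn.of_locally_bounded_eventually
    (isOpen_lt continuous_const continuous_re) fun K hK hKc => ?_
  obtain ⟨δ, R, hδ, -, h⟩ := exists_le_re_norm_le_of_isCompact hK hKc
  obtain ⟨C, hC, hb⟩ := exists_norm_exp_mul_lerchRat_le v k
  refine ⟨_, (summable_int_one_add_abs_pow_mul_exp hδ 0).mul_left (C * Real.exp (δ * |c|)), ?_⟩
  filter_upwards [eventually_cofinite_le_abs (1 / δ + |c|)] with n hn α hα
  have hre : (I * y + ((c + n : ℝ) : ℂ) * α).re = (c + n) * α.re := by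
    rw [add_re, re_ofReal_mul]; simp
  have habs : |(n : ℝ)| - |c| ≤ |c + n| := by
    have := abs_sub_abs_le_abs_sub (n : ℝ) (-c)
    rwa [abs_neg, sub_neg_eq_add, add_comm (n : ℝ)] at this
  have h1 : δ * (|(n : ℝ)| - |c|) ≤ |(I * y + ((c + n : ℝ) : ℂ) * α).re| := by
    rw [hre, abs_mul, abs_of_pos (show 0 < α.re from hK hα), mul_comm δ]
    have := (h α hα).1
    have h0 : 0 ≤ |(n : ℝ)| - |c| := by
      have : 0 < 1 / δ := by positivity
      linarith
    gcongr
  refine (hb _ (le_trans ?_ h1)).trans ?_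
  · have : 1 / δ ≤ |(n : ℝ)| - |c| := by linarith
    rwa [div_le_iff₀ hδ, mul_comm] at this
  · rw [pow_zero, one_mul, mul_assoc, ← Real.exp_add]
    gcongr
    linarith

theorem differentiableAt_sechTerm (L : ℂ) (k : ℕ) (y c : ℝ) (n : ℤ) {α : ℂ} (hα : 0 < α.re) :
    DifferentiableAt ℂ (fun α : ℂ => sechTerm (fun s => (L + s) ^ (k : ℂ)) (I * y + c * α)
      (2 * Real.pi * n / α)) α := by
  have h0 : α ≠ 0 := by rintro rfl; simp at hα
  have h1 : DifferentiableAt ℂ (fun α : ℂ => 2 * Real.pi * n / α) α :=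
    (differentiableAt_const _).div differentiableAt_id h0
  simp only [sechTerm, cpow_natCast]
  refine DifferentiableAt.mul (by fun_prop) (DifferentiableAt.div (by fun_prop) (by fun_prop) ?_)
  rcases eq_or_ne n 0 with rfl | hn
  · simp
  · apply cosh_ne_zero_of_re_ne_zero
    rw [show (Real.pi * (2 * Real.pi * n / α) / 2 : ℂ) = ((Real.pi ^ 2 * n : ℝ) : ℂ) / α by
      push_cast; ring, re_ofReal_div]
    have : (n : ℝ) ≠ 0 := by exact_mod_cast hn
    have := (inv_re_pos hα).ne'
    have := Real.pi_ne_zero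
    positivity

theorem summableLocallyUniformlyOn_sechTerm (L : ℂ) (k : ℕ) {y : ℝ} (hy : |y| < Real.pi / 2)
    (c : ℝ) :
    SummableLocallyUniformlyOn
      (fun (n : ℤ) (α : ℂ) => sechTerm (fun s => (L + s) ^ (k : ℂ)) (I * y + c * α)
        (2 * Real.pi * n / α)) {α | 0 < α.re} := by
  refine SummableLocallyUniformlyOn.of_locally_bounded_eventually
    (isOpen_lt continuous_const continuous_re) fun K hK hKc => ?_
  obtain ⟨δ, R, hδ, hR, h⟩ := exists_le_re_norm_le_of_isCompact hK hKc
  have hpi := Real.pi_pos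
  set ρ : ℝ := δ / R ^ 2 with hρ
  have hρ0 : 0 < ρ := by positivity
  -- With `r = Re(1/α)`, sech contributes `e^(-π²|n|r)` and the exponential at most `e^(2π|y||n|r)`,
  -- while `c` gives only a phase. The net rate `B r` is positive because `|y| < π/2`, and `r ≥ ρ`
  -- on the compact set.
  set B : ℝ := Real.pi ^ 2 - 2 * Real.pi * |y| with hB
  have hB0 : 0 < B := by rw [hB]; nlinarith
  refine ⟨_, (summable_int_one_add_abs_pow_mul_exp (mul_pos hB0 hρ0) k).mul_left
    ((‖L‖ + 2 * Real.pi / δ) ^ k * 4), ?_⟩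
  filter_upwards [eventually_cofinite_le_abs (1 / (Real.pi ^ 2 * ρ))] with n hn α hα
  obtain ⟨h1, h2⟩ := h α hα
  have hα0 : 0 < α.re := hK hα
  have hα1 : α ≠ 0 := by rintro rfl; simp at hα0
  have hαn : δ ≤ ‖α‖ := h1.trans ((le_abs_self _).trans (abs_re_le_norm α))
  set r : ℝ := (α⁻¹).re with hr
  have hr0 : 0 < r := inv_re_pos hα0
  have hρr : ρ ≤ r := by
    rw [hr, inv_re, normSq_eq_norm_sq, hρ]
    gcongr
  rw [div_le_iff₀ (by positivity)] at hn
  have hcosh : Real.exp (Real.pi ^ 2 * |(n : ℝ)| * r) ≤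
      4 * ‖Complex.cosh (Real.pi * (2 * Real.pi * n / α) / 2)‖ := by
    have e : (Real.pi * (2 * Real.pi * n / α) / 2 : ℂ) = ((Real.pi ^ 2 * n : ℝ) : ℂ) / α := by
      push_cast; ring
    have e2 : |(Real.pi * (2 * Real.pi * n / α) / 2 : ℂ).re| = Real.pi ^ 2 * |(n : ℝ)| * r := by
      rw [e, re_ofReal_div, abs_mul, abs_mul, abs_of_pos hr0, abs_of_pos (by positivity)]
    rw [← e2]
    apply exp_abs_re_le_norm_cosh
    rw [e2]
    refine hn.trans ?_
    calc |(n : ℝ)| * (Real.pi ^ 2 * ρ) = Real.pi ^ 2 * |(n : ℝ)| * ρ := by ring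
      _ ≤ _ := by gcongr
  have hexp : ‖cexp (2 * Real.pi * n / α * I * (I * y + c * α))‖ ≤
      Real.exp (2 * Real.pi * |y| * |(n : ℝ)| * r) := by
    rw [norm_exp, Real.exp_le_exp]
    have e : (2 * Real.pi * n / α * I * (I * y + c * α) : ℂ) =
        ((-(2 * Real.pi * n * y) : ℝ) : ℂ) / α + ((2 * Real.pi * n * c : ℝ) : ℂ) * I := by
      push_cast
      field_simp
      linear_combination (n : ℂ) * y * I_sq
    rw [e, add_re, re_ofReal_div, re_ofReal_mul, I_re, mul_zero, add_zero]
    gcongr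
    calc -(2 * Real.pi * n * y) ≤ |2 * Real.pi * n * y| := neg_le_abs _
      _ = _ := by
        rw [abs_mul, abs_mul, abs_of_pos (by positivity : 0 < 2 * Real.pi)]; ring
  have hpow : ‖L + 2 * Real.pi * n / α * I‖ ≤ (‖L‖ + 2 * Real.pi / δ) * (1 + |(n : ℝ)|) := by
    have e : ‖(2 * Real.pi * n / α * I : ℂ)‖ ≤ 2 * Real.pi * |(n : ℝ)| / δ := by
      rw [norm_mul, norm_I, mul_one, norm_div,
        show (2 * Real.pi * n : ℂ) = ((2 * Real.pi * n : ℝ) : ℂ) by push_cast; rfl, norm_real,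
        Real.norm_eq_abs, abs_mul, abs_of_pos (by positivity : 0 < 2 * Real.pi)]
      gcongr
    refine (norm_add_le _ _).trans ((add_le_add_right e _).trans ?_)
    have : 0 ≤ ‖L‖ * |(n : ℝ)| + 2 * Real.pi / δ := by positivity
    rw [mul_div_right_comm]
    linarith
  have hcpos : 0 < ‖Complex.cosh (Real.pi * (2 * Real.pi * n / α) / 2)‖ := by
    linarith [Real.exp_pos (Real.pi ^ 2 * |(n : ℝ)| * r)]
  have hquot : ‖cexp (2 * Real.pi * n / α * I * (I * y + c * α)) /
      Complex.cosh (Real.pi * (2 * Real.pi * n / α) / 2)‖ ≤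
      4 * Real.exp (-(B * ρ) * |(n : ℝ)|) := by
    rw [norm_div, div_le_iff₀ hcpos]
    calc _ ≤ Real.exp (2 * Real.pi * |y| * |(n : ℝ)| * r) := hexp
      _ = Real.exp (-(B * r) * |(n : ℝ)|) * Real.exp (Real.pi ^ 2 * |(n : ℝ)| * r) := by
          rw [← Real.exp_add, hB]; ring_nf
      _ ≤ Real.exp (-(B * ρ) * |(n : ℝ)|) *
          (4 * ‖Complex.cosh (Real.pi * (2 * Real.pi * n / α) / 2)‖) := by gcongr
      _ = _ := by ring
  rw [sechTerm, cpow_natCast, norm_mul, norm_pow]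
  calc _ ≤ ((‖L‖ + 2 * Real.pi / δ) * (1 + |(n : ℝ)|)) ^ k *
        (4 * Real.exp (-(B * ρ) * |(n : ℝ)|)) := by gcongr
    _ = _ := by rw [mul_pow]; ring

/-! ### The identity for real and then for complex `α`. -/

/-- Both series converge absolutely and their sums agree up to the constant factor. -/
def LerchPoisson (α m k L : ℂ) : Prop :=
  (Summable fun n : ℤ => cexp (m + n * α) *
    lerchPhi (-cexp (2 * (m + n * α))) (-k) (1 / 2 * (L + 1))) ∧
  (Summable fun n : ℤ => sechTerm (fun s => (L + s) ^ k) m (2 * Real.pi * n / α)) ∧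
  ∑' n : ℤ, cexp (m + n * α) * lerchPhi (-cexp (2 * (m + n * α))) (-k) (1 / 2 * (L + 1)) =
    2 ^ (-k - 2) * (2 * Real.pi / α) *
      ∑' n : ℤ, sechTerm (fun s => (L + s) ^ k) m (2 * Real.pi * n / α)

theorem abs_im_add_int_mul_lt {m : ℂ} {a : ℝ} (hm : |m.im| < Real.pi / 2) (n : ℤ) :
    |(m + n * a).im| < Real.pi / 2 := by
  have : (m + n * a).im = m.im := by
    rw [add_im, ← ofReal_intCast, ← ofReal_mul, ofReal_im, add_zero]
  rwa [this]

theorem PolyGrowth.lerchPoisson {L k m : ℂ} (hP : PolyGrowth fun s => (L + s) ^ k) {a : ℝ}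
    (ha : 0 < a) (hm : |m.im| < Real.pi / 2)
    (hs : Summable fun n : ℤ => sechTransform (fun s => (L + s) ^ k) (m + n * a)) :
    LerchPoisson a m k L := by
  have h1 : ∀ n : ℤ, cexp (m + n * a) *
      lerchPhi (-cexp (2 * (m + n * a))) (-k) (1 / 2 * (L + 1)) =
      2 ^ (-k - 2) * sechTransform (fun s => (L + s) ^ k) (m + n * a) := fun n =>
    hP.exp_mul_lerchPhi (abs_im_add_int_mul_lt hm n)
  obtain ⟨h2, h3⟩ := hP.poisson hm ha hs
  refine ⟨?_, h2, ?_⟩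
  · simp_rw [h1]
    exact hs.mul_left _
  · simp_rw [h1]
    rw [tsum_mul_left, h3, mul_assoc]

theorem lerchPoisson_of_real {L k m : ℂ} (hL : 0 ≤ L.re) (h : 0 < L.re ∨ 0 < k.re) {a : ℝ}
    (ha : 0 < a) (hm : |m.im| < Real.pi / 2) : LerchPoisson a m k L := by
  refine (polyGrowth_add_cpow hL h).lerchPoisson ha hm ?_
  obtain ⟨σ, hσ, K, hK⟩ := exists_norm_sechTransform_cpow_le hL h hm
  have hs : Summable fun n : ℤ => K * a ^ (-(1 + σ)) * |(n : ℝ)| ^ (-(1 + σ)) :=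
    (Real.summable_abs_int_rpow (by linarith)).mul_left _
  refine Summable.of_norm_bounded_eventually hs ?_
  filter_upwards [eventually_cofinite_le_abs 1] with n hn
  have hn0 : (n : ℝ) ≠ 0 := by
    rintro h0
    rw [h0] at hn
    norm_num at hn
  have := hK (n * a) (mul_ne_zero hn0 ha.ne')
  rw [abs_mul, abs_of_pos ha, Real.mul_rpow (abs_nonneg _) ha.le] at this
  push_cast at this
  linarith

theorem exp_mul_lerchPhi_eq_lerchTerm (L : ℂ) (k : ℕ) {w : ℂ} (hw : Complex.cosh w ≠ 0) :
    cexp w * lerchPhi (-cexp (2 * w)) (-k) (1 / 2 * (L + 1)) =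
      lerchTerm (1 / 2 * (L + 1)) k w := by
  rw [lerchPhi_neg_natCast _ _ (neg_exp_two_mul_ne_one hw), lerchTerm]

theorem frequently_ofReal_nhdsNE_one :
    ∃ᶠ z : ℂ in 𝓝[≠] 1, ∃ a : ℝ, 0 < a ∧ z = a := by
  have h : Tendsto (fun n : ℕ => ((1 + 1 / ((n : ℝ) + 1) : ℝ) : ℂ)) atTop (𝓝[≠] 1) := by
    refine tendsto_nhdsWithin_iff.2 ⟨?_, Eventually.of_forall fun n => ?_⟩
    · have := (tendsto_const_nhds (x := (1 : ℝ))).add tendsto_one_div_add_atTop_nhds_zero_nat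
      rw [add_zero] at this
      exact ofReal_one ▸ (continuous_ofReal.tendsto 1).comp this
    · rw [mem_compl_singleton_iff, ← ofReal_one, Ne, ofReal_inj]
      have : 0 < 1 / ((n : ℝ) + 1) := by positivity
      linarith
  exact h.frequently (Frequently.of_forall fun n => ⟨_, by positivity, rfl⟩)

/-- Analytic continuation in `α` with the real coordinates `y`, `c` of `m = iy + cα` held fixed, so
that `m` moves with `α`. For `α > 0` Poisson applies, since the rational form already gives
summability for arbitrary `L`. -/
theorem lerchPoisson_natCast {α m L : ℂ} (k : ℕ) (hα : 0 < α.re)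
    (hm : |(m * (starRingEnd ℂ) α).im| < Real.pi / 2 * α.re) : LerchPoisson α m k L := by
  set c : ℝ := m.re / α.re with hc
  set y : ℝ := (m * (starRingEnd ℂ) α).im / α.re with hy'
  have hy : |y| < Real.pi / 2 := by
    rw [hy', abs_div, abs_of_pos hα, div_lt_iff₀ hα]
    exact hm
  have hmy : m = I * y + c * α := by
    apply Complex.ext
    · simp [hc, hα.ne']
    · simp only [hc, hy', add_im, mul_im, I_re, I_im, ofReal_re, ofReal_im, conj_re, conj_im]
      field_simp
      ring
  have hline : ∀ (α : ℂ) (n : ℤ), I * y + c * α + n * α = I * y + ((c + n : ℝ) : ℂ) * α := by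
    intro α n; push_cast; ring
  have hU : IsOpen {z : ℂ | 0 < z.re} := isOpen_lt continuous_const continuous_re
  set v : ℂ := 1 / 2 * (L + 1) with hv
  have hterm : ∀ α : ℂ, 0 < α.re → ∀ n : ℤ, cexp (I * y + c * α + n * α) *
      lerchPhi (-cexp (2 * (I * y + c * α + n * α))) (-k) v =
      lerchTerm v k (I * y + ((c + n : ℝ) : ℂ) * α) := by
    intro α hα n
    rw [hline]
    exact exp_mul_lerchPhi_eq_lerchTerm L k (cosh_line_ne_zero hy hα)
  have hl := summableLocallyUniformlyOn_lerchTerm v k y c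
  have hr := summableLocallyUniformlyOn_sechTerm L k hy c
  have hld : DifferentiableOn ℂ (fun α : ℂ => ∑' n : ℤ,
      lerchTerm v k (I * y + ((c + n : ℝ) : ℂ) * α)) {z : ℂ | 0 < z.re} := by
    refine hl.differentiableOn hU fun n α hα => ?_
    exact DifferentiableAt.comp (f := fun α : ℂ => I * y + ((c + n : ℝ) : ℂ) * α)
      (g := lerchTerm v k) α (differentiableAt_lerchTerm v k (cosh_line_ne_zero hy hα))
      (by fun_prop)
  have hrd : DifferentiableOn ℂ (fun α : ℂ => 2 ^ (-(k : ℂ) - 2) * (2 * Real.pi / α) *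
      ∑' n : ℤ, sechTerm (fun s => (L + s) ^ (k : ℂ)) (I * y + c * α) (2 * Real.pi * n / α))
      {z : ℂ | 0 < z.re} := by
    refine DifferentiableOn.mul ?_
      (hr.differentiableOn hU fun n α hα => differentiableAt_sechTerm L k y c n hα)
    refine (differentiableOn_const _).mul ((differentiableOn_const _).div differentiableOn_id ?_)
    rintro z hz rfl
    simp at hz
  have hreal : ∀ a : ℝ, 0 < a → LerchPoisson a (I * y + c * a) k L := by
    intro a ha
    have him : |(I * y + c * (a : ℂ)).im| < Real.pi / 2 := by simpa using hy
    have hP := polyGrowth_add_pow L k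
    refine hP.lerchPoisson ha him ?_
    have hs := (hl.summable (show ((a : ℝ) : ℂ) ∈ {z : ℂ | 0 < z.re} by simpa using ha)).mul_left
      ((2 : ℂ) ^ (-(k : ℂ) - 2))⁻¹
    refine hs.congr fun n => ?_
    rw [← hterm a (by simpa using ha) n,
      hP.exp_mul_lerchPhi (abs_im_add_int_mul_lt him n), inv_mul_cancel_left₀]
    simp [cpow_eq_zero_iff]
  -- Agreement on the positive reals, which accumulate at 1, suffices on the connected right half
  -- plane.
  have heq : EqOn _ _ {z : ℂ | 0 < z.re} :=
    (hld.analyticOnNhd hU).eqOn_of_preconnected_of_frequently_eq (hrd.analyticOnNhd hU)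
      (convex_halfSpace_re_gt 0).isPreconnected (z₀ := 1) (by simp)
      (frequently_ofReal_nhdsNE_one.mono fun z ⟨a, ha, hz⟩ => by
        have h := (hreal a ha).2.2
        rw [hz]
        rw [← h]
        exact tsum_congr fun n => (hterm a (by simpa using ha) n).symm)
  rw [LerchPoisson, hmy]
  refine ⟨(hl.summable (show α ∈ {z : ℂ | 0 < z.re} from hα)).congr fun n =>
    (hterm α hα n).symm, hr.summable (show α ∈ {z : ℂ | 0 < z.re} from hα), ?_⟩
  rw [tsum_congr (hterm α hα)]
  exact heq hα

/-! ### Pairing `n` with `-n` and conclusion. -/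

/-- With `x = e^(2πinm/α)`, the bracket times `e^(-2πinm/α)` is `x (L + 2πin/α)^k + x⁻¹ (L -
2πin/α)^k`. As cosh is even, these are the dual terms at `n` and `-n`. -/
theorem dual_term_eq {α : ℂ} (m k L : ℂ) (hα : α ≠ 0) (n : ℤ) :
    (Real.pi : ℂ) * 2 ^ (-k - 2) * Complex.exp (m * (-1 - 2 * Complex.I * Real.pi * n / α)) *
      (1 / Complex.cosh ((Real.pi : ℂ) ^ 2 * n / α)) *
      (Complex.exp (4 * Complex.I * Real.pi * m * n / α) *
          (L + 2 * Complex.I * Real.pi * n / α) ^ k +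
        (L - 2 * Complex.I * Real.pi * n / α) ^ k) / α =
    cexp (-m) * (2 ^ (-k - 2) * (Real.pi / α)) *
      (sechTerm (fun s => (L + s) ^ k) m (2 * Real.pi * n / α) +
        sechTerm (fun s => (L + s) ^ k) m (2 * Real.pi * (-n : ℤ) / α)) := by
  have e1 : (Real.pi * (2 * Real.pi * n / α) / 2 : ℂ) = (Real.pi : ℂ) ^ 2 * n / α := by ring
  have e2 : (Real.pi * (2 * Real.pi * (-n : ℤ) / α) / 2 : ℂ) = -((Real.pi : ℂ) ^ 2 * n / α) := by
    push_cast; ring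
  have e3 : (2 * Real.pi * n / α * I : ℂ) = 2 * I * Real.pi * n / α := by ring
  have e4 : (2 * Real.pi * (-n : ℤ) / α * I : ℂ) = -(2 * I * Real.pi * n / α) := by
    push_cast; ring
  have e5 : (4 * I * Real.pi * m * n / α : ℂ) =
      2 * I * Real.pi * n / α * m + 2 * I * Real.pi * n / α * m := by ring
  have e6 : m * (-1 - 2 * I * Real.pi * n / α) = -m + -(2 * I * Real.pi * n / α * m) := by ring
  have e7 := Complex.exp_ne_zero (2 * I * Real.pi * n / α * m)
  simp only [sechTerm]
  rw [e1, e2, e3, e4, e5, e6, Complex.cosh_neg, neg_mul, Complex.exp_add, Complex.exp_add,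
    Complex.exp_neg (2 * I * Real.pi * n / α * m), ← sub_eq_add_neg]
  generalize cexp (2 * I * Real.pi * n / α * m) = x at e7 ⊢
  generalize (L + 2 * I * Real.pi * n / α) ^ k = p
  generalize (L - 2 * I * Real.pi * n / α) ^ k = q
  by_cases h : Complex.cosh ((Real.pi : ℂ) ^ 2 * n / α) = 0
  · simp [h]
  · generalize Complex.cosh ((Real.pi : ℂ) ^ 2 * n / α) = d at h ⊢
    field_simp

theorem theorem3p21 (α m k a : ℂ) (ha : a ≠ 0) (hα : 0 < α.re)
    (hm : |(m * (starRingEnd ℂ) α).im| < Real.pi / 2 * α.re)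
    (hk : (∃ j : ℕ, k = (j : ℂ)) ∨
      (α.im = 0 ∧ (1 < ‖a‖ ∨ (‖a‖ = 1 ∧ 0 < k.re)))) :
    Summable (fun n : ℤ => Complex.exp (α * n) *
      lerchPhi (-Complex.exp (2 * (m + n * α))) (-k) (1 / 2 * (Complex.log a + 1))) ∧
    Summable (fun n : ℤ => (Real.pi : ℂ) * 2 ^ (-k - 2) *
      Complex.exp (m * (-1 - 2 * Complex.I * Real.pi * n / α)) *
      (1 / Complex.cosh ((Real.pi : ℂ) ^ 2 * n / α)) *
      (Complex.exp (4 * Complex.I * Real.pi * m * n / α) *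
          (Complex.log a + 2 * Complex.I * Real.pi * n / α) ^ k +
        (Complex.log a - 2 * Complex.I * Real.pi * n / α) ^ k) / α) ∧
    (∑' n : ℤ, Complex.exp (α * n) *
      lerchPhi (-Complex.exp (2 * (m + n * α))) (-k) (1 / 2 * (Complex.log a + 1))) =
    ∑' n : ℤ, (Real.pi : ℂ) * 2 ^ (-k - 2) *
      Complex.exp (m * (-1 - 2 * Complex.I * Real.pi * n / α)) *
      (1 / Complex.cosh ((Real.pi : ℂ) ^ 2 * n / α)) *
      (Complex.exp (4 * Complex.I * Real.pi * m * n / α) *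
          (Complex.log a + 2 * Complex.I * Real.pi * n / α) ^ k +
        (Complex.log a - 2 * Complex.I * Real.pi * n / α) ^ k) / α := by
  have hα0 : α ≠ 0 := by rintro rfl; simp at hα
  have hcore : LerchPoisson α m k (Complex.log a) := by
    rcases hk with ⟨j, rfl⟩ | ⟨hαim, h⟩
    · exact lerchPoisson_natCast j hα hm
    · have hαr : α = ((α.re : ℝ) : ℂ) := by apply Complex.ext <;> simp [hαim]
      have him : |m.im| < Real.pi / 2 := by
        rw [hαr, conj_ofReal, im_mul_ofReal, abs_mul, ofReal_re, abs_of_pos hα] at hm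
        exact lt_of_mul_lt_mul_right hm hα.le
      rw [hαr]
      refine lerchPoisson_of_real ?_ ?_ hα him <;> rw [log_re]
      · rcases h with h | h
        · exact Real.log_nonneg h.le
        · simp [h.1]
      · exact h.imp Real.log_pos And.right
  obtain ⟨h1, h2, h3⟩ := hcore
  have h2' : Summable fun n : ℤ =>
      sechTerm (fun s => (Complex.log a + s) ^ k) m (2 * Real.pi * (-n : ℤ) / α) :=
    (Equiv.neg ℤ).summable_iff.2 h2
  have hneg : ∑' n : ℤ, sechTerm (fun s => (Complex.log a + s) ^ k) m
      (2 * Real.pi * (-n : ℤ) / α) =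
      ∑' n : ℤ, sechTerm (fun s => (Complex.log a + s) ^ k) m (2 * Real.pi * n / α) :=
    (Equiv.neg ℤ).tsum_eq fun n : ℤ =>
      sechTerm (fun s => (Complex.log a + s) ^ k) m (2 * Real.pi * n / α)
  have hl : ∀ n : ℤ, Complex.exp (α * n) *
      lerchPhi (-Complex.exp (2 * (m + n * α))) (-k) (1 / 2 * (Complex.log a + 1)) =
      cexp (-m) * (cexp (m + n * α) *
        lerchPhi (-Complex.exp (2 * (m + n * α))) (-k) (1 / 2 * (Complex.log a + 1))) := by
    intro n
    rw [← mul_assoc, ← Complex.exp_add]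
    ring_nf
  simp_rw [dual_term_eq m k (Complex.log a) hα0, hl]
  refine ⟨h1.mul_left _, (h2.add h2').mul_left _, ?_⟩
  -- The paired sum is twice the dual sum, which turns the factor `π/α` into the `2π/α` of Poisson
  -- summation.
  rw [tsum_mul_left, tsum_mul_left, h2.tsum_add h2', hneg, h3]
  ring
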